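/- \textbf{Definitions.} Fix a schema: finitely many relation names with arities. Constants come from a countably infinite domain (binary strings). An \emph{instance} (or database state), and likewise a \emph{transaction}, is a finite set of ground tuples for the relations of the schema. An \emph{inclusion dependency} $R[A_{i_1},\dots,A_{i_k}]\subseteq R'[B_{j_1},\dots,B_{j_k}]$ (with $B_{j_1},\dots,B_{j_k}$ pairwise distinct) holds in an instance if for every tuple $t$ of $R$ there is a tuple $t'$ of $R'$ with $t[A_{i_l}]=t'[B_{j_l}]$ for all $l\le k$. A \emph{blockchain database with inclusion dependencies} is a triple $\mathcal D=(\mathcal R,\mathcal I,\mathcal T)$, where $\mathcal R$ is an instance (the current state), $\mathcal I$ is a set of inclusion dependencies with $\mathcal R\models\mathcal I$, and $\mathcal T$ is a finite set of (pending) transactions. An instance $\mathcal W'$ \emph{can be appended from} $\mathcal W$ if $\mathcal W'=\mathcal W$, or $\mathcal W'=\mathcal W\cup T$ for some $T\in\mathcal T$ and $\mathcal W'\models\mathcal I$. The \emph{possible worlds} of $\mathcal D$ are the instances related to $\mathcal R$ by the transitive closure of this relation. Let $\mathcal T_{in},\mathcal T_{out}\subseteq\mathcal T$, let $T$ be a transaction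 and let $\mathcal D'=(\mathcal R,\mathcal I,\mathcal T\cup\{T\})$. Then $T$ is \emph{$(\mathcal T_{in},\mathcal T_{out})$-separating} for $\mathcal D$ if (i) some possible world of $\mathcal D'$ contains $T\cup\bigcup_{T'\in\mathcal T_{in}}T'$, and (ii) no possible world of $\mathcal D'$ that contains $T$ contains any $T'\in\mathcal T_{out}$ as a subset. It is \emph{minimal} if, moreover, no strict subset of $T$ is $(\mathcal T_{in},\mathcal T_{out})$-separating. \textbf{Theorem.} For every fixed schema and every fixed set $\mathcal I$ of inclusion dependencies over it, there is an algorithm that, given a blockchain database $\mathcal D=(\mathcal R,\mathcal I,\mathcal T)$ and sets $\mathcal T_{in},\mathcal T_{out}\subseteq\mathcal T$ (with $\mathcal R$, $\mathcal T$, $\mathcal T_{in}$, $\mathcal T_{out}$ written out as lists of ground tuples, respectively lists of transactions), runs in time polynomial in the length of this input on a multi-stack Turing machine and returns a minimal $(\mathcal T_{in},\mathcal T_{out})$-separating transaction for $\mathcal D$ if a $(\mathcal T_{in},\mathcal T_{out})$-separating transaction exists, and otherwise reports that none exists. -/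

import Mathlib

namespace BlockchainDB

/-- A database schema: finitely many relation names, each with an arity. The attributes of
relation `r` are the elements of `Fin (arity r)`. -/
structure Schema where
  numRel : ℕ
  arity : Fin numRel → ℕ

/-- Constants: the countably infinite domain of binary strings. -/
abbrev Const : Type := List Bool

/-- A ground tuple for one of the relations of the schema. -/
abbrev Fact (S : Schema) : Type := (r : Fin S.numRel) × (Fin (S.arity r) → Const)

/-- A finite set of ground tuples for the relations of the schema. It serves both as the contents
of all the relations (a database state) and as an insert transaction. -/
abbrev Instance (S : Schema) : Type := Finset (Fact S)

/-- An inclusion dependency `R[A_{i_1}, …, A_{i_k}] ⊆ R'[B_{j_1}, …, B_{j_k}]`, with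
`B_{j_1}, …, B_{j_k}` pairwise distinct. -/
structure InclusionDependency (S : Schema) where
  src : Fin S.numRel
  dst : Fin S.numRel
  width : ℕ
  lhs : Fin width → Fin (S.arity src)
  rhs : Fin width → Fin (S.arity dst)
  rhs_injective : Function.Injective rhs

/-- The state `I` satisfies the inclusion dependency `d`. -/
def InclusionDependency.Holds {S : Schema} (d : InclusionDependency S) (I : Instance S) : Prop :=
  ∀ t : Fin (S.arity d.src) → Const, (⟨d.src, t⟩ : Fact S) ∈ I →
    ∃ t' : Fin (S.arity d.dst) → Const, (⟨d.dst, t'⟩ : Fact S) ∈ I ∧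
      ∀ l, t (d.lhs l) = t' (d.rhs l)

/-- `I ⊨ ic`. -/
def Satisfies {S : Schema} (I : Instance S) (ic : Set (InclusionDependency S)) : Prop :=
  ∀ d ∈ ic, d.Holds I

/-- A blockchain database `(R, ic, 𝒯)` all of whose integrity constraints are inclusion
dependencies. -/
structure Database (S : Schema) where
  state : Instance S
  ic : Set (InclusionDependency S)
  pending : Finset (Instance S)
  consistent : Satisfies state ic

namespace Database

variable {S : Schema}

/-- The can-append relationship between states. -/
def CanAppend (D : Database S) (W W' : Instance S) : Prop :=
  W' = W ∨ ∃ T ∈ D.pending, W' = W ∪ T ∧ Satisfies W' D.ic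

/-- Possible worlds: the states related to the current one by the transitive closure of the
can-append relationship. -/
def IsPossibleWorld (D : Database S) (W : Instance S) : Prop :=
  Relation.TransGen D.CanAppend D.state W

/-- The database `(R, ic, 𝒯 ∪ {T})`. -/
def issue (D : Database S) (T : Instance S) : Database S where
  state := D.state
  ic := D.ic
  pending := insert T D.pending
  consistent := D.consistent

/-- `T` is mutually consistent with `Tin`. -/
def MutuallyConsistent (D : Database S) (Tin : Finset (Instance S)) (T : Instance S) : Prop :=
  ∃ W, (D.issue T).IsPossibleWorld W ∧ T ∪ Tin.biUnion id ⊆ W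

/-- `T` is inconsistent with `Tout`. -/
def InconsistentWith (D : Database S) (Tout : Finset (Instance S)) (T : Instance S) : Prop :=
  ∀ W, (D.issue T).IsPossibleWorld W → T ⊆ W → ∀ T' ∈ Tout, ¬ T' ⊆ W

/-- `T` is a `(Tin, Tout)`-separating transaction for `D`. -/
def IsSeparating (D : Database S) (Tin Tout : Finset (Instance S)) (T : Instance S) : Prop :=
  D.MutuallyConsistent Tin T ∧ D.InconsistentWith Tout T

/-- `T` is a minimal `(Tin, Tout)`-separating transaction for `D`: it is separating, and no strict
subset of it is. -/
def IsMinimalSeparating (D : Database S) (Tin Tout : Finset (Instance S)) (T : Instance S) :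
    Prop :=
  D.IsSeparating Tin Tout T ∧ ∀ T', T' ⊂ T → ¬ D.IsSeparating Tin Tout T'

end Database

/-- The finite alphabet in which inputs and outputs are written. -/
inductive Symbol (S : Schema) where
  | rel (r : Fin S.numRel)
  | bit (b : Bool)
  | endConst
  | endTx
  | endList
  deriving DecidableEq, Fintype

/-- Written form of a ground tuple: its relation name, then its constants, each followed by a
terminator. -/
def encodeFact {S : Schema} (t : Fact S) : List (Symbol S) :=
  .rel t.1 :: (List.ofFn t.2).flatMap fun c => c.map .bit ++ [.endConst]

/-- Written form of a set of ground tuples that is given as a list. -/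
def encodeTx {S : Schema} (T : List (Fact S)) : List (Symbol S) :=
  T.flatMap encodeFact ++ [.endTx]

/-- Written form of a set of transactions that is given as a list. -/
def encodeTxs {S : Schema} (Ts : List (List (Fact S))) : List (Symbol S) :=
  Ts.flatMap encodeTx ++ [.endList]

/-- An input of the minimal separating transaction problem over a fixed schema and fixed
constraints: lists of the current state, of the pending transactions, of `Tin` and of `Tout`. -/
structure Input (S : Schema) where
  state : List (Fact S)
  pending : List (List (Fact S))
  tin : List (List (Fact S))
  tout : List (List (Fact S))

/-- The set of transactions listed by `Ts` (in any order, possibly with repetitions). -/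
def toTransactions {S : Schema} (Ts : List (List (Fact S))) : Finset (Instance S) :=
  (Ts.map List.toFinset).toFinset

/-- The input `x` lists the state and the pending transactions of `D`, and `Tin` and `Tout`. -/
def Input.Represents {S : Schema} (x : Input S) (D : Database S)
    (Tin Tout : Finset (Instance S)) : Prop :=
  x.state.toFinset = D.state ∧ toTransactions x.pending = D.pending ∧
    toTransactions x.tin = Tin ∧ toTransactions x.tout = Tout

/-- The input word. Its length is the size of the input. -/
def encodeInput {S : Schema} (x : Input S) : List (Symbol S) :=
  encodeTx x.state ++ encodeTxs x.pending ++ encodeTxs x.tin ++ encodeTxs x.tout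

/-- The output word: the empty word for `none` (no separating transaction exists), and otherwise
the tuples of the transaction. -/
def encodeOutput {S : Schema} : Option (List (Fact S)) → List (Symbol S)
  | none => []
  | some T => encodeTx T

end BlockchainDB

open BlockchainDB

/-! Everything rests on one fact, `Satisfies.union`: inclusion dependencies are preserved by unions,
since adding tuples never destroys a witness. If `W ⊆ V`, `V` is consistent and `W ∪ T` is
consistent, then so is `V ∪ T = V ∪ (W ∪ T)`. Hence appending greedily from a consistent base leads
to a largest world, independent of the order and monotone in the base (`IsLargestWorld`). Let `M` be
the largest world of the database and `V(T)` the largest world above `M ∪ T`. Then `T` is separating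
iff `M ∪ T` is consistent, `V(T)` contains the union of `Tin`, and `V(T)` contains no member of
`Tout` (`isSeparating_iff`).

For existence, a single candidate `C` is enough: chase the union of `Tin`, filling every
undetermined position with one constant `c` that occurs in no pending transaction. Reusing the same
`c` keeps the chase finite and, for a fixed schema, polynomial. If `T` is separating, then every
tuple of `V(C)` is matched by a tuple of `V(T)` that agrees with it wherever it does not hold `c`
(`dominated_chase`, `dominated_largestWorld`). Members of `Tout` are pending, hence free of `c`, so
one contained in `V(C)` would be contained in `V(T)`. Thus `C` is separating whenever anything is.

For minimality, subsets of `C` inherit the exclusion of `Tout` because `V` is monotone, so only the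
condition that `Tin` be enabled matters. It passes from a consistent set to every larger consistent
set. One pass over the tuples of `C` therefore suffices: try to delete each tuple, replacing the
rest by its largest part consistent with `M`, and keep the smaller set if `Tin` is still enabled
(`foldl_dropIfPossible`).

For the running time, structured programs on stacks are compiled to multi-stack machines
(`Run.code`), and the functions they compute in polynomial time are shown to be closed under
composition, pairing, branching and folds with accumulators of polynomial size. All fixed-point
computations are iterated filters of a list given in advance, so their intermediate results stay
small. -/

/-! ### Structured stack programs and their compilation to multi-stack Turing machines -/

namespace StackProgram

open Function (update)

/-- Structured programs over registers indexed by `ℕ`, each holding a stack of symbols.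
`loop k isEnd body` pops `k` until it is empty or a symbol satisfying `isEnd` has been popped, and
runs `body a` after popping any other symbol `a`. -/
inductive Prog (Γ : Type) : Type where
  | skip : Prog Γ
  | push (k : ℕ) (a : Γ) : Prog Γ
  | pop (k : ℕ) (branch : Option Γ → Prog Γ) : Prog Γ
  | seq (p q : Prog Γ) : Prog Γ
  | loop (k : ℕ) (isEnd : Γ → Bool) (body : Γ → Prog Γ) : Prog Γ

variable {Γ : Type}

/-- `Run p s s' t`: started with register contents `s`, the program `p` terminates after `t` steps
with register contents `s'`. -/
inductive Run : Prog Γ → (ℕ → List Γ) → (ℕ → List Γ) → ℕ → Prop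
  | skip {s} : Run .skip s s 1
  | push {k a s} : Run (.push k a) s (update s k (a :: s k)) 1
  | pop {k br s s' t} : Run (br (s k).head?) (update s k (s k).tail) s' t →
      Run (.pop k br) s s' (t + 1)
  | seq {p q s s' s'' t t'} : Run p s s' t → Run q s' s'' t' → Run (.seq p q) s s'' (t + t')
  | loop_nil {k isEnd body s} : s k = [] → Run (.loop k isEnd body) s s 1
  | loop_isEnd {k isEnd body s a w} : s k = a :: w → isEnd a = true →
      Run (.loop k isEnd body) s (update s k w) 1
  | loop_cons {k isEnd body s s' s'' a w t t'} : s k = a :: w → isEnd a = false →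
      Run (body a) (update s k w) s' t → Run (.loop k isEnd body) s' s'' t' →
      Run (.loop k isEnd body) s s'' (t + t' + 1)

theorem Run.cast {p : Prog Γ} {s s' s'' : ℕ → List Γ} {t t' : ℕ} (h : Run p s s' t)
    (hs : s' = s'') (ht : t = t') : Run p s s'' t' := hs ▸ ht ▸ h

/-- A register grows by at most one symbol per step. -/
theorem Run.length_le {p : Prog Γ} {s s' : ℕ → List Γ} {t : ℕ} (h : Run p s s' t) (i : ℕ) :
    (s' i).length ≤ (s i).length + t := by
  induction h with
  | skip => simp
  | @push k a s =>
    by_cases hi : i = k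
    · subst hi; simp
    · simp [hi]
  | @pop k br s s' t _ ih =>
    refine ih.trans ?_
    by_cases hi : i = k
    · subst hi; simp; omega
    · simp [hi]
  | seq _ _ ih₁ ih₂ => omega
  | loop_nil => simp
  | @loop_isEnd k isEnd body s a w hk =>
    by_cases hi : i = k
    · subst hi; simp [hk]; omega
    · simp [hi]
  | @loop_cons k isEnd body s s' s'' a w t t' hk _ _ _ ih₁ ih₂ =>
    by_cases hi : i = k
    · subst hi; simp [hk] at ih₁ ⊢; omega
    · simp [hi] at ih₁; omega

namespace Prog

/-- All registers used by the program are below `N`. -/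
def UsesBelow (N : ℕ) : Prog Γ → Prop
  | skip => True
  | push k _ => k < N
  | pop k br => k < N ∧ ∀ o, (br o).UsesBelow N
  | seq p q => p.UsesBelow N ∧ q.UsesBelow N
  | loop k _ body => k < N ∧ ∀ a, (body a).UsesBelow N

theorem UsesBelow.mono {N M : ℕ} (h : N ≤ M) : ∀ {p : Prog Γ}, p.UsesBelow N → p.UsesBelow M
  | skip, _ => trivial
  | push _ _, hp => lt_of_lt_of_le hp h
  | pop _ _, hp => ⟨hp.1.trans_le h, fun o => (hp.2 o).mono h⟩
  | seq _ _, hp => ⟨hp.1.mono h, hp.2.mono h⟩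
  | loop _ _ _, hp => ⟨hp.1.trans_le h, fun a => (hp.2 a).mono h⟩

/-- Labels of the machine code of a program. -/
def Label : Prog Γ → Type
  | skip => Unit
  | push _ _ => Unit
  | pop _ br => Option (Σ o, (br o).Label)
  | seq p q => p.Label ⊕ q.Label
  | loop _ _ body => Option (Σ a, (body a).Label)

theorem finite_label [Finite Γ] : ∀ p : Prog Γ, Finite p.Label
  | skip => inferInstanceAs (Finite Unit)
  | push _ _ => inferInstanceAs (Finite Unit)
  | pop _ br =>
    have := fun o => finite_label (br o)
    inferInstanceAs (Finite (Option (Σ o, (br o).Label)))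
  | seq p q =>
    have := finite_label p
    have := finite_label q
    inferInstanceAs (Finite (p.Label ⊕ q.Label))
  | loop _ _ body =>
    have := fun a => finite_label (body a)
    inferInstanceAs (Finite (Option (Σ a, (body a).Label)))

/-- The label at which the code of a program starts. -/
def entry : (p : Prog Γ) → p.Label
  | skip => ()
  | push _ _ => ()
  | pop _ _ => none
  | seq p _ => Sum.inl p.entry
  | loop _ _ _ => none

/-- Register `k` as a stack of a machine with `N + 1` stacks. -/
def _root_.StackProgram.reg (N k : ℕ) : Fin (N + 1) := Fin.ofNat (N + 1) k

/-- Machine code of a program, inside a machine with labels `Λ` that contains the labels of the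
program via `emb`, with control passing to `exit` at the end. -/
def code {Λ : Type} (N : ℕ) : (p : Prog Γ) → (p.Label → Λ) → Λ → p.Label →
    Turing.TM2.Stmt (fun _ : Fin (N + 1) => Γ) Λ (Option Γ)
  | skip, _, exit, _ => .goto fun _ => exit
  | push k a, _, exit, _ => .push (reg N k) (fun _ => a) (.goto fun _ => exit)
  | pop k br, emb, _, none =>
    .pop (reg N k) (fun _ o => o) (.goto fun o => emb (some ⟨o, (br o).entry⟩))
  | pop _ br, emb, exit, some ⟨o, l⟩ => (br o).code N (fun l => emb (some ⟨o, l⟩)) exit l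
  | seq p q, emb, _, Sum.inl l => p.code N (fun l => emb (Sum.inl l)) (emb (Sum.inr q.entry)) l
  | seq _ q, emb, exit, Sum.inr l => q.code N (fun l => emb (Sum.inr l)) exit l
  | loop k isEnd body, emb, exit, none =>
    .pop (reg N k) (fun _ o => o) (.goto fun o => match o with
      | none => exit
      | some a => bif isEnd a then exit else emb (some ⟨a, (body a).entry⟩))
  | loop _ _ body, emb, _, some ⟨a, l⟩ =>
    (body a).code N (fun l => emb (some ⟨a, l⟩)) (emb none) l

end Prog

/-! ### Step-by-step simulation of programs by multi-stack machines. -/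

open Turing

theorem val_reg {N k : ℕ} (hk : k < N + 1) : (reg N k : ℕ) = k := by
  simp [reg, Fin.ofNat, Nat.mod_eq_of_lt hk]

theorem update_reg {N k : ℕ} (hk : k < N + 1) (s : ℕ → List Γ) (w : List Γ) :
    update (fun i : Fin (N + 1) => s i) (reg N k) w =
      fun i : Fin (N + 1) => update s k w i := by
  funext i
  by_cases h : i = reg N k
  · subst h
    simp [val_reg hk]
  · have : (i : ℕ) ≠ k := fun h' => h (Fin.ext (by rw [val_reg hk, h']))
    rw [Function.update_of_ne h, Function.update_of_ne this]

/-- The machine code of a program simulates its runs step by step. -/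
theorem Run.code {N : ℕ} {Λ : Type} {M : Λ → TM2.Stmt (fun _ : Fin (N + 1) => Γ) Λ (Option Γ)}
    {p : Prog Γ} {s s' : ℕ → List Γ} {t : ℕ} (h : Run p s s' t) :
    ∀ (emb : p.Label → Λ) (exit : Λ), p.UsesBelow (N + 1) →
      (∀ l, M (emb l) = p.code N emb exit l) → ∀ v, ∃ v',
        (flip bind (TM2.step M))^[t] (some ⟨some (emb p.entry), v, fun i => s i⟩) =
          some ⟨some exit, v', fun i => s' i⟩ := by
  induction h with
  | @skip s =>
    intro emb exit _ hM v
    refine ⟨v, ?_⟩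
    change some (TM2.stepAux (M (emb Prog.skip.entry)) v _) = _
    rw [hM]
    rfl
  | @push k a s =>
    intro emb exit hN hM v
    refine ⟨v, ?_⟩
    change some (TM2.stepAux (M (emb (Prog.push k a).entry)) v _) = _
    rw [show M (emb (Prog.push k a).entry) = _ from hM ()]
    simp only [Prog.code, TM2.stepAux, update_reg hN, val_reg hN]
  | @pop k br s s' t _ ih =>
    intro emb exit hN hM v
    obtain ⟨v', hv'⟩ := ih (fun l => emb (some ⟨_, l⟩)) exit (hN.2 _)
      (fun l => hM (some ⟨_, l⟩)) (s k).head?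
    refine ⟨v', ?_⟩
    rw [Function.iterate_succ_apply, ← hv']
    congr 1
    change some (TM2.stepAux (M (emb (Prog.pop k br).entry)) v _) = _
    rw [show M (emb (Prog.pop k br).entry) = _ from hM none]
    simp only [Prog.code, TM2.stepAux, update_reg hN.1]
    rw [val_reg hN.1]
  | @seq p q s s' s'' t t' _ _ ih₁ ih₂ =>
    intro emb exit hN hM v
    obtain ⟨v₁, hv₁⟩ := ih₁ (fun l => emb (Sum.inl l)) (emb (Sum.inr q.entry)) hN.1
      (fun l => hM (Sum.inl l)) v
    obtain ⟨v₂, hv₂⟩ := ih₂ (fun l => emb (Sum.inr l)) exit hN.2 (fun l => hM (Sum.inr l)) v₁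
    refine ⟨v₂, ?_⟩
    -- `iterate_add_apply` applies the second summand first, so the steps of `p` have to stand on
    -- the right.
    rw [Nat.add_comm t t', Function.iterate_add_apply]
    exact (congrArg _ hv₁).trans hv₂
  | @loop_nil k isEnd body s hk =>
    intro emb exit hN hM v
    refine ⟨none, ?_⟩
    have hs : update s k [] = s := by rw [← hk, Function.update_eq_self]
    change some (TM2.stepAux (M (emb (Prog.loop k isEnd body).entry)) v _) = _
    rw [show M (emb (Prog.loop k isEnd body).entry) = _ from hM none]
    simp only [Prog.code, TM2.stepAux, update_reg hN.1, val_reg hN.1, hk, List.head?_nil,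
      List.tail_nil, hs]
  | @loop_isEnd k isEnd body s a w hk hs =>
    intro emb exit hN hM v
    refine ⟨some a, ?_⟩
    change some (TM2.stepAux (M (emb (Prog.loop k isEnd body).entry)) v _) = _
    rw [show M (emb (Prog.loop k isEnd body).entry) = _ from hM none]
    simp only [Prog.code, TM2.stepAux, update_reg hN.1, val_reg hN.1, hk, List.head?_cons,
      List.tail_cons, hs, cond_true]
  | @loop_cons k isEnd body s s' s'' a w t t' hk hs _ _ ih₁ ih₂ =>
    intro emb exit hN hM v
    obtain ⟨v₁, hv₁⟩ := ih₁ (fun l => emb (some ⟨a, l⟩)) (emb none) (hN.2 a)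
      (fun l => hM (some ⟨a, l⟩)) (some a)
    obtain ⟨v₂, hv₂⟩ := ih₂ emb exit hN hM v₁
    refine ⟨v₂, ?_⟩
    rw [Function.iterate_succ_apply, Nat.add_comm t t', Function.iterate_add_apply, ← hv₂]
    congr 1
    refine Eq.trans ?_ hv₁
    congr 1
    change some (TM2.stepAux (M (emb (Prog.loop k isEnd body).entry)) v _) = _
    rw [show M (emb (Prog.loop k isEnd body).entry) = _ from hM none]
    simp only [Prog.code, TM2.stepAux, update_reg hN.1, val_reg hN.1, hk, List.head?_cons,
      List.tail_cons, hs, cond_false]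

/-- The machine that runs a program, with register `0` for input and output. -/
noncomputable def Prog.machine [Fintype Γ] (N : ℕ) (p : Prog Γ) : FinTM2 :=
  letI := p.finite_label
  { K := Fin (N + 1)
    k₀ := 0
    k₁ := 0
    Γ := fun _ => Γ
    Λ := Option p.Label
    main := some p.entry
    ΛFin := Fintype.ofFinite _
    σ := Option Γ
    initialState := none
    Γk₀Fin := inferInstance
    m := fun l => match l with
      -- A halting configuration must carry the initial internal state, so the exit label resets it;
      -- this is the one step added in `Prog.machine_outputs`.
      | none => .load (fun _ => none) .halt
      | some l => p.code N some none l }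

/-- Halting configurations have all stacks but the output stack empty, which is why the final store
must be empty outside register `0`. -/
theorem Prog.machine_outputs [Fintype Γ] {N : ℕ} {p : Prog Γ} {w w' : List Γ} {t : ℕ}
    (hN : p.UsesBelow (N + 1))
    (h : Run p (update (fun _ => []) 0 w) (update (fun _ => []) 0 w') t) :
    Nonempty (TM2OutputsInTime (p.machine N) w (some w') (t + 1)) := by
  have hinit : ∀ u : List Γ, (fun k : Fin (N + 1) => @dite (List Γ) (k = 0) _ (fun _ => u)
      (fun _ => [])) = fun i : Fin (N + 1) => update (fun _ => []) 0 u (i : ℕ) := by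
    intro u
    funext k
    by_cases hk : k = 0
    · subst hk; simp
    · have : (k : ℕ) ≠ 0 := fun h => hk (Fin.ext h)
      simp [hk, this]
  obtain ⟨v', hv'⟩ := h.code (M := (p.machine N).m) (fun l => (some l : Option p.Label)) none hN
    (fun _ => rfl) none
  refine ⟨⟨⟨t + 1, ?_⟩, le_rfl⟩⟩
  rw [Function.iterate_succ_apply']
  refine (congrArg (flip bind (p.machine N).step) (Eq.trans ?_ hv')).trans ?_
  · refine congrArg _ (congrArg some ?_)
    exact congrArg (TM2.Cfg.mk (some (some p.entry)) none) (hinit w)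
  · exact congrArg some (congrArg (TM2.Cfg.mk none none) (hinit w').symm)

end StackProgram

/-! ### Basic stack programs -/

namespace StackProgram

open Function (update)

variable {Γ : Type}

namespace Prog

/-- Pop `i` until it is empty. -/
def clear (i : ℕ) : Prog Γ := loop i (fun _ => false) fun _ => skip

/-- Move the contents of `i` to `j`, reversed. -/
def move (i j : ℕ) : Prog Γ := loop i (fun _ => false) fun a => push j a

/-- Move the contents of `i` to both `j` and `k`, reversed. -/
def dup (i j k : ℕ) : Prog Γ := loop i (fun _ => false) fun a => seq (push j a) (push k a)

/-- Push a fixed word. -/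
def pushWord (i : ℕ) : List Γ → Prog Γ
  | [] => skip
  | a :: w => seq (pushWord i w) (push i a)

end Prog

open Prog

theorem run_clear (i : ℕ) (s : ℕ → List Γ) :
    Run (clear i) s (update s i []) (2 * (s i).length + 1) := by
  obtain ⟨w, hw⟩ : ∃ w, s i = w := ⟨_, rfl⟩
  induction w generalizing s with
  | nil => exact (Run.loop_nil hw).cast (by rw [← hw, Function.update_eq_self]) (by simp [hw])
  | cons a w ih =>
    exact (Run.loop_cons hw rfl .skip (ih (update s i w) (by simp))).cast (by simp)
      (by simp [hw]; ring)

theorem run_move {i j : ℕ} (hij : i ≠ j) (s : ℕ → List Γ) :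
    Run (move i j) s (update (update s i []) j ((s i).reverse ++ s j)) (2 * (s i).length + 1) := by
  obtain ⟨w, hw⟩ : ∃ w, s i = w := ⟨_, rfl⟩
  induction w generalizing s with
  | nil =>
    refine (Run.loop_nil hw).cast ?_ (by simp [hw])
    funext n
    simp only [Function.update_apply]
    split_ifs <;> simp_all
  | cons a w ih =>
    refine (Run.loop_cons hw rfl .push (ih _ (by simp [hij]))).cast ?_ ?_
    · funext n
      simp only [Function.update_apply]
      split_ifs <;> simp_all
    · simp [hw, hij]; ring

theorem run_dup {i j k : ℕ} (hij : i ≠ j) (hik : i ≠ k) (hjk : j ≠ k) (s : ℕ → List Γ) :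
    Run (dup i j k) s
      (update (update (update s i []) j ((s i).reverse ++ s j)) k ((s i).reverse ++ s k))
      (3 * (s i).length + 1) := by
  obtain ⟨w, hw⟩ : ∃ w, s i = w := ⟨_, rfl⟩
  induction w generalizing s with
  | nil =>
    refine (Run.loop_nil hw).cast ?_ (by simp [hw])
    funext n
    simp only [Function.update_apply]
    split_ifs <;> simp_all
  | cons a w ih =>
    refine (Run.loop_cons hw rfl (.seq .push .push) (ih _ (by simp [hij, hik]))).cast ?_ ?_
    · funext n
      simp only [Function.update_apply]
      split_ifs <;> simp_all
    · simp [hw, hij, hik]; ring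

theorem run_pushWord (i : ℕ) (w : List Γ) (s : ℕ → List Γ) :
    Run (pushWord i w) s (update s i (w ++ s i)) (w.length + 1) := by
  induction w with
  | nil => exact Run.skip.cast (by simp) rfl
  | cons a w ih => exact (Run.seq ih .push).cast (by simp) (by simp)

/-- The registers `s` with new contents for register `0` and for the five registers above `N`. -/
def frame (N : ℕ) (s : ℕ → List Γ) (u c b a x y : List Γ) : ℕ → List Γ := fun n =>
  if n = 0 then u else if n = N + 1 then c else if n = N + 2 then b else if n = N + 3 then a
  else if n = N + 4 then x else if n = N + 5 then y else s n

/-! ### Reads and writes on stores with five scratch registers. -/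

section

variable (N : ℕ) (s : ℕ → List Γ) (u c b a x y w : List Γ)

@[simp] theorem frame_zero : frame N s u c b a x y 0 = u := by simp [frame]
@[simp] theorem frame_one : frame N s u c b a x y (N + 1) = c := by simp [frame]
@[simp] theorem frame_two : frame N s u c b a x y (N + 2) = b := by simp [frame]
@[simp] theorem frame_three : frame N s u c b a x y (N + 3) = a := by simp [frame]
@[simp] theorem frame_four : frame N s u c b a x y (N + 4) = x := by simp [frame]
@[simp] theorem frame_five : frame N s u c b a x y (N + 5) = y := by simp [frame]

@[simp] theorem update_frame_zero :
    update (frame N s u c b a x y) 0 w = frame N s w c b a x y := by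
  funext n; simp only [frame, Function.update_apply]; split_ifs <;> rfl
@[simp] theorem update_frame_one :
    update (frame N s u c b a x y) (N + 1) w = frame N s u w b a x y := by
  funext n; simp only [frame, Function.update_apply]; split_ifs <;> first | rfl | omega
@[simp] theorem update_frame_two :
    update (frame N s u c b a x y) (N + 2) w = frame N s u c w a x y := by
  funext n; simp only [frame, Function.update_apply]; split_ifs <;> first | rfl | omega
@[simp] theorem update_frame_three :
    update (frame N s u c b a x y) (N + 3) w = frame N s u c b w x y := by
  funext n; simp only [frame, Function.update_apply]; split_ifs <;> first | rfl | omega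
@[simp] theorem update_frame_four :
    update (frame N s u c b a x y) (N + 4) w = frame N s u c b a w y := by
  funext n; simp only [frame, Function.update_apply]; split_ifs <;> first | rfl | omega
@[simp] theorem update_frame_five :
    update (frame N s u c b a x y) (N + 5) w = frame N s u c b a x w := by
  funext n; simp only [frame, Function.update_apply]; split_ifs <;> first | rfl | omega

variable {N s}

theorem frame_of_lt {i : ℕ} (h : 0 < i) (h' : i < N + 1) : frame N s u c b a x y i = s i := by
  simp only [frame]; split_ifs <;> first | rfl | omega

/-- Brings a store with empty work registers into the form in which `simp` evaluates programs. -/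
theorem eq_frame (h : ∀ i, 0 < i → i < N + 6 → s i = []) :
    s = frame N s (s 0) [] [] [] [] [] := by
  funext n
  simp only [frame]
  split_ifs with h₀
  · rw [h₀]
  all_goals first | rfl | exact h n (by omega) (by omega)

theorem eq_frame_zero (h : ∀ i, 0 < i → i < 6 → s i = []) :
    s = frame 0 s (s 0) [] [] [] [] [] := eq_frame (N := 0) h

end

/-- An alphabet with two distinguished symbols, used to delimit blocks. -/
class Marked (Γ : Type) where
  more : Γ
  last : Γ
  more_ne_last : more ≠ last

variable [Marked Γ]

open Marked

/-- Self-delimiting form of a word. -/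
def block : List Γ → List Γ
  | [] => [last]
  | a :: w => more :: a :: block w

@[simp] theorem length_block (w : List Γ) : (block w).length = 2 * w.length + 1 := by
  induction w with
  | nil => rfl
  | cons a w ih => simp [block, ih]; ring

/-- Marks stand at every second position and announce whether another symbol follows. Blocks are
therefore prefix-free whatever their contents, even if these include the marks. -/
theorem block_append_inj {u v : List Γ} : ∀ {w w' : List Γ},
    block w ++ u = block w' ++ v → w = w' ∧ u = v
  | [], [], h => by simpa [block] using h
  | [], _ :: _, h => absurd (List.cons.inj h).1.symm more_ne_last
  | _ :: _, [], h => absurd (List.cons.inj h).1 more_ne_last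
  | a :: w, b :: w', h => by
    obtain ⟨h₁, h₂⟩ := List.cons.inj (List.cons.inj h).2
    obtain ⟨h₃, h₄⟩ := block_append_inj h₂
    exact ⟨by rw [h₁, h₃], h₄⟩

namespace Prog

/-- Remove a block from the top of `i` and put its contents on `j`, reversed. -/
def unblock [DecidableEq Γ] (i j : ℕ) : Prog Γ :=
  loop i (fun a => decide (a = last)) fun _ => pop i fun o => match o with
    | none => skip
    | some a => push j a

/-- Move the contents of `i`, reversed, to `j` as a block. -/
def putBlock (i j : ℕ) : Prog Γ :=
  seq (push j last) (loop i (fun _ => false) fun a => seq (push j a) (push j more))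

end Prog

theorem run_unblock [DecidableEq Γ] {i j : ℕ} (hij : i ≠ j) {w r : List Γ} {s : ℕ → List Γ}
    (h : s i = block w ++ r) :
    Run (unblock i j) s (update (update s i r) j (w.reverse ++ s j)) (3 * w.length + 1) := by
  induction w generalizing s with
  | nil =>
    refine (Run.loop_isEnd h (by simp)).cast ?_ rfl
    simp [hij.symm]
  | cons a w ih =>
    have h₁ : Run (unblock i j) s _ _ := Run.loop_cons h (by simp [more_ne_last])
      (.pop (s' := update (update s i (block w ++ r)) j (a :: s j))
        (by simpa [hij, hij.symm] using (@Run.push _ j a (update s i (block w ++ r)))))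
      (ih (by simp [hij]))
    refine h₁.cast ?_ ?_
    · funext n
      simp only [Function.update_apply]
      split_ifs <;> simp_all
    · simp; ring

theorem run_putBlock {i j : ℕ} (hij : i ≠ j) (s : ℕ → List Γ) :
    Run (putBlock i j) s (update (update s i []) j (block (s i).reverse ++ s j))
      (3 * (s i).length + 2) := by
  -- Invariant: the top of `j` is a block of what has been moved so far; pushing `a` and then `more`
  -- extends this block at its front.
  have main : ∀ (w v r : List Γ) (s : ℕ → List Γ), s i = w → s j = block v ++ r →
      Run (loop i (fun _ => false) fun a => seq (push j a) (push j more)) s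
        (update (update s i []) j (block (w.reverse ++ v) ++ r)) (3 * w.length + 1) := by
    intro w
    induction w with
    | nil =>
      intro v r s hw hj
      refine (Run.loop_nil hw).cast ?_ (by simp)
      funext n
      simp only [Function.update_apply]
      split_ifs <;> simp_all
    | cons a w ih =>
      intro v r s hw hj
      refine (Run.loop_cons hw rfl (.seq .push .push)
        (ih (a :: v) r _ (by simp [hij]) (by simp [hij.symm, hj, block]))).cast ?_ ?_
      · funext n
        simp only [Function.update_apply]
        split_ifs <;> simp_all
      · simp; ring
  refine (Run.seq .push (main (s i) [] (s j) _ (by simp [hij]) (by simp [block]))).cast ?_ ?_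
  · funext n
    simp only [Function.update_apply]
    split_ifs <;> simp_all
  · ring

end StackProgram

/-! ### Functions computable by stack programs in polynomial time -/

namespace StackProgram

open Function (update)

theorem eval_le_eval (P : Polynomial ℕ) {m n : ℕ} (h : m ≤ n) : P.eval m ≤ P.eval n := by
  rw [Polynomial.eval_eq_sum, Polynomial.eval_eq_sum]
  exact Finset.sum_le_sum fun i _ => Nat.mul_le_mul_left _ (Nat.pow_le_pow_left h i)

/-- An injective encoding of `α` by words over `Γ`. -/
class Enc (Γ : Type) (α : Type*) where
  enc : α → List Γ
  enc_injective : Function.Injective enc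

open Enc (enc enc_injective)

variable {Γ : Type} [Marked Γ]

instance : Enc Γ Γ where
  enc a := [a]
  enc_injective := fun _ _ h => (List.cons.inj h).1

instance : Enc Γ Bool where
  enc b := if b then [Marked.more] else []
  enc_injective := by intro a b h; cases a <;> cases b <;> simp_all

instance {α β : Type*} [Enc Γ α] [Enc Γ β] : Enc Γ (α × β) where
  enc x := block (enc x.1) ++ enc x.2
  enc_injective := fun _ _ h =>
    Prod.ext (enc_injective (block_append_inj h).1) (enc_injective (block_append_inj h).2)

/-- Encoding of a list. -/
def encList {α : Type*} [Enc Γ α] : List α → List Γ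
  | [] => []
  | a :: l => block (enc a) ++ encList l

theorem encList_injective {α : Type*} [Enc Γ α] : ∀ {l l' : List α},
    (encList l : List Γ) = encList l' → l = l'
  | [], [], _ => rfl
  | [], a :: l', h => by
    have := congrArg List.length h
    simp only [encList, List.length_append, length_block, List.length_nil] at this
    omega
  | a :: l, [], h => by
    have := congrArg List.length h
    simp only [encList, List.length_append, length_block, List.length_nil] at this
    omega
  | a :: l, b :: l', h => by
    obtain ⟨h₁, h₂⟩ := block_append_inj h
    rw [enc_injective h₁, encList_injective h₂]

instance {α : Type*} [Enc Γ α] : Enc Γ (List α) where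
  enc := encList
  enc_injective := fun _ _ h => encList_injective h

section

variable {α β : Type*} [Enc Γ α] [Enc Γ β]

theorem enc_pair (a : α) (b : β) : (enc (a, b) : List Γ) = block (enc a) ++ enc b := rfl

theorem enc_nil : (enc ([] : List α) : List Γ) = [] := rfl

theorem enc_cons (a : α) (l : List α) : (enc (a :: l) : List Γ) = block (enc a) ++ enc l := rfl

theorem enc_append (l l' : List α) : (enc (l ++ l') : List Γ) = enc l ++ enc l' := by
  induction l with
  | nil => rfl
  | cons a l ih => rw [List.cons_append, enc_cons, ih, enc_cons, List.append_assoc]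

theorem length_enc_le_of_sublist {l l' : List α} (h : l.Sublist l') :
    (enc l : List Γ).length ≤ (enc l' : List Γ).length := by
  induction h with
  | slnil => exact le_rfl
  | cons a _ ih => rw [enc_cons, List.length_append]; omega
  | cons_cons a _ ih => simp only [enc_cons, List.length_append]; omega

theorem length_le_length_enc (l : List α) : l.length ≤ (enc l : List Γ).length := by
  induction l with
  | nil => simp
  | cons a l ih => simp only [enc_cons, List.length_append, List.length_cons, length_block]; omega

theorem length_enc_le_of_mem {a : α} {l : List α} (h : a ∈ l) :
    (enc a : List Γ).length ≤ (enc l : List Γ).length := by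
  induction h with
  | head l => simp only [enc_cons, List.length_append, length_block]; omega
  | tail b _ ih => simp only [enc_cons, List.length_append]; omega

end

/-- The program `p`, using registers below `N`, replaces the encoding of `x` in register `0` by that
of `f x`, in time at most `P` of the length of the former. -/
def Computes {α β : Type*} [Enc Γ α] [Enc Γ β] (p : Prog Γ) (N : ℕ) (P : Polynomial ℕ) (f : α → β) :
    Prop :=
  ∀ x (s : ℕ → List Γ), s 0 = enc x → (∀ i, 0 < i → i < N → s i = []) →
    ∃ t ≤ P.eval (enc x : List Γ).length, Run p s (update s 0 (enc (f x))) t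

/-- Polynomial time computability by stack programs. -/
def PolyTime (Γ : Type) [Marked Γ] {α β : Type*} [Enc Γ α] [Enc Γ β] (f : α → β) : Prop :=
  ∃ (p : Prog Γ) (N : ℕ) (P : Polynomial ℕ), 0 < N ∧ p.UsesBelow N ∧ Computes p N P f

namespace PolyTime

variable {α β γ δ : Type*} [Enc Γ α] [Enc Γ β] [Enc Γ γ] [Enc Γ δ]

/-- A register gains at most one symbol per step, so a time bound is also a bound on the length of
the output; compositions need this. -/
theorem exists_length_le {f : α → β} (hf : PolyTime Γ f) :
    ∃ P : Polynomial ℕ, ∀ x, (enc (f x) : List Γ).length ≤ P.eval (enc x : List Γ).length := by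
  obtain ⟨p, N, P, _, _, h⟩ := hf
  refine ⟨Polynomial.X + P, fun x => ?_⟩
  obtain ⟨t, ht, hr⟩ := h x (update (fun _ => []) 0 (enc x)) (by simp)
    (fun i hi _ => by simp [hi.ne'])
  have := hr.length_le 0
  simp at this ⊢
  omega

/-- Computability concerns words only: a change of type that leaves the encoding alone costs
nothing. -/
theorem of_enc_eq {f : α → β} (h : ∀ x, (enc (f x) : List Γ) = enc x) : PolyTime Γ f :=
  ⟨.skip, 1, 1, one_pos, trivial, fun x s hs _ => ⟨1, by simp, Run.skip.cast
    (by rw [h, ← hs, Function.update_eq_self]) rfl⟩⟩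

theorem id : PolyTime Γ (fun x : α => x) := of_enc_eq fun _ => rfl

theorem comp {g : β → γ} {f : α → β} (hg : PolyTime Γ g) (hf : PolyTime Γ f) :
    PolyTime Γ fun x => g (f x) := by
  obtain ⟨B, hB⟩ := hf.exists_length_le
  obtain ⟨p, N, P, hN, hp, hP⟩ := hf
  obtain ⟨q, M, Q, hM, hq, hQ⟩ := hg
  refine ⟨.seq p q, max N M, P + Q.comp B, by omega,
    ⟨hp.mono (le_max_left _ _), hq.mono (le_max_right _ _)⟩, fun x s hs h0 => ?_⟩
  obtain ⟨t, ht, hr⟩ := hP x s hs fun i hi hi' => h0 i hi (by omega)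
  obtain ⟨t', ht', hr'⟩ := hQ (f x) (update s 0 (enc (f x))) (by simp)
    fun i hi hi' => by simp [hi.ne', h0 i hi (by omega)]
  refine ⟨t + t', ?_, (Run.seq hr hr').cast (by simp) rfl⟩
  have := eval_le_eval Q (hB x)
  simp only [Polynomial.eval_add, Polynomial.eval_comp]
  omega

theorem const (b : β) : PolyTime Γ fun _ : α => b := by
  refine ⟨.seq (.clear 0) (.pushWord 0 (enc b)), 1, 2 * Polynomial.X + 1 +
    Polynomial.C ((enc b : List Γ).length + 1), one_pos, ⟨⟨one_pos, fun _ => trivial⟩, ?_⟩,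
    fun x s hs _ => ⟨_, ?_, (Run.seq (run_clear 0 s) (run_pushWord 0 (enc b) _)).cast ?_ rfl⟩⟩
  · generalize (enc b : List Γ) = w
    induction w with
    | nil => trivial
    | cons a w ih => exact ⟨ih, one_pos⟩
  · simp [hs]
  · simp

theorem fst [DecidableEq Γ] : PolyTime Γ (Prod.fst : α × β → α) := by
  refine ⟨.seq (.unblock 0 1) (.seq (.clear 0) (.move 1 0)), 2, 10 * Polynomial.X + 10, by simp, ?_,
    fun x s hs h0 => ?_⟩
  · simp [Prog.UsesBelow, Prog.unblock, Prog.clear, Prog.move]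
    exact fun _ o => by cases o <;> simp [Prog.UsesBelow]
  · have h1 : s 1 = [] := h0 1 (by simp) (by simp)
    refine ⟨_, ?_, (Run.seq (run_unblock (by simp) (hs.trans (enc_pair _ _)))
      (.seq (run_clear 0 _) (run_move (by simp) _))).cast ?_ rfl⟩
    · simp [h1, enc_pair x.1 x.2]; omega
    · funext n
      simp only [Function.update_apply]
      split_ifs <;> simp_all

theorem snd [DecidableEq Γ] : PolyTime Γ (Prod.snd : α × β → β) := by
  refine ⟨.seq (.unblock 0 1) (.clear 1), 2, 10 * Polynomial.X + 10, by simp, ?_,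
    fun x s hs h0 => ?_⟩
  · simp [Prog.UsesBelow, Prog.unblock, Prog.clear]
    exact fun _ o => by cases o <;> simp [Prog.UsesBelow]
  · have h1 : s 1 = [] := h0 1 (by simp) (by simp)
    refine ⟨_, ?_, (Run.seq (run_unblock (by simp) (hs.trans (enc_pair _ _)))
      (run_clear 1 _)).cast ?_ rfl⟩
    · simp [h1, enc_pair x.1 x.2]; omega
    · funext n
      simp only [Function.update_apply]
      split_ifs <;> simp_all

theorem append [DecidableEq Γ] : PolyTime Γ (fun x : List α × List α => x.1 ++ x.2) := by
  refine ⟨.seq (.unblock 0 1) (.move 1 0), 2, 10 * Polynomial.X + 10, by simp, ?_,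
    fun x s hs h0 => ?_⟩
  · simp [Prog.UsesBelow, Prog.unblock, Prog.move]
    exact fun _ o => by cases o <;> simp [Prog.UsesBelow]
  · have h1 : s 1 = [] := h0 1 (by simp) (by simp)
    refine ⟨_, ?_, (Run.seq (run_unblock (by simp) (hs.trans (enc_pair _ _)))
      (run_move (by simp) _)).cast ?_ rfl⟩
    · simp [h1, enc_pair x.1 x.2]; omega
    · funext n
      simp only [Function.update_apply, enc_append]
      split_ifs <;> simp_all

/-- A program for `f` or `g` leaves all registers but `0` as it found them and does not need those
from its own bound upwards to be empty. So the spare copy of the input and the first result can wait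
in registers above both bounds. -/
theorem pair {f : α → β} {g : α → γ} (hf : PolyTime Γ f) (hg : PolyTime Γ g) :
    PolyTime Γ fun x => (f x, g x) := by
  obtain ⟨B, hB⟩ := hf.exists_length_le
  obtain ⟨p, N₁, P, hN, hp, hP⟩ := hf
  obtain ⟨q, N₂, Q, hM, hq, hQ⟩ := hg
  obtain ⟨N, hN'⟩ : ∃ N, N = max N₁ N₂ := ⟨_, rfl⟩
  refine ⟨.seq (.dup 0 (N + 1) (N + 2)) (.seq (.move (N + 1) 0) (.seq p (.seq (.move 0 (N + 1))
    (.seq (.move (N + 2) 0) (.seq q (.putBlock (N + 1) 0)))))), N + 6,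
    P + Q + 10 * Polynomial.X + 10 * B + 10, by omega, ?_, fun x s hs h0 => ?_⟩
  · have hp' := hp.mono (show N₁ ≤ N + 6 by omega)
    have hq' := hq.mono (show N₂ ≤ N + 6 by omega)
    simp [Prog.UsesBelow, Prog.dup, Prog.move, Prog.putBlock, hp', hq']
  · have hs' := eq_frame h0
    rw [hs] at hs'
    rw [hs']
    have hst : ∀ u c b a x y i, 0 < i → i < N + 1 → frame N s u c b a x y i = [] :=
      fun u c b a x y i h h' => by rw [frame_of_lt _ _ _ _ _ _ h h', h0 i h (by omega)]
    have r₁ : Run (.dup 0 (N + 1) (N + 2)) (frame N s (enc x) [] [] [] [] [])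
        (frame N s [] (enc x : List Γ).reverse (enc x : List Γ).reverse [] [] []) _ :=
      (run_dup (by omega) (by omega) (by omega) _).cast (by simp) rfl
    have r₂ : Run (.move (N + 1) 0) _
        (frame N s (enc x) [] (enc x : List Γ).reverse [] [] []) _ :=
      (run_move (by omega) (frame N s [] (enc x : List Γ).reverse (enc x : List Γ).reverse [] [] [])).cast
        (by simp) rfl
    obtain ⟨t₁, ht₁, r₃⟩ := hP x (frame N s (enc x) [] (enc x : List Γ).reverse [] [] []) (by simp)
      fun i hi hi' => hst _ _ _ _ _ _ i hi (by omega)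
    rw [update_frame_zero] at r₃
    have r₄ : Run (.move 0 (N + 1)) _
        (frame N s [] (enc (f x) : List Γ).reverse (enc x : List Γ).reverse [] [] []) _ :=
      (run_move (by omega) (frame N s (enc (f x)) [] (enc x : List Γ).reverse [] [] [])).cast
        (by simp) rfl
    have r₅ : Run (.move (N + 2) 0) _
        (frame N s (enc x) (enc (f x) : List Γ).reverse [] [] [] []) _ :=
      (run_move (by omega)
        (frame N s [] (enc (f x) : List Γ).reverse (enc x : List Γ).reverse [] [] [])).cast
        (by simp) rfl
    obtain ⟨t₂, ht₂, r₆⟩ := hQ x (frame N s (enc x) (enc (f x) : List Γ).reverse [] [] [] [])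
      (by simp) fun i hi hi' => hst _ _ _ _ _ _ i hi (by omega)
    rw [update_frame_zero] at r₆
    have r₇ := run_putBlock (i := N + 1) (j := 0) (by omega)
      (frame N s (enc (g x)) (enc (f x) : List Γ).reverse [] [] [] [])
    refine ⟨_, ?_, (Run.seq r₁ (.seq r₂ (.seq r₃ (.seq r₄ (.seq r₅ (.seq r₆ r₇)))))).cast ?_ rfl⟩
    · have := hB x
      simp
      omega
    · simp [enc_pair]

/-- Program for folding with the step `p`, which uses registers up to `N`. -/
def foldProg [DecidableEq Γ] (N : ℕ) (p : Prog Γ) : Prog Γ :=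
  .seq (.unblock 0 (N + 1)) <| .seq (.unblock 0 (N + 2)) <| .seq (.move 0 (N + 4)) <|
  .seq (.move (N + 4) (N + 3)) <|
  .seq (.loop (N + 3) (fun _ => false) fun a =>
    .seq (.push (N + 3) a) <| .seq (.unblock (N + 3) (N + 4)) <| .seq (.move (N + 4) 0) <|
    .seq (.putBlock (N + 2) 0) <| .seq (.move (N + 1) (N + 4)) <|
    .seq (.dup (N + 4) (N + 1) (N + 5)) <| .seq (.putBlock (N + 5) 0) <|
    .seq p (.move 0 (N + 2))) <|
  .seq (.move (N + 2) 0) (.clear (N + 1))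

/-- One round of the fold. Context, accumulator and remaining list wait in registers `N + 1`, `N +
2` and `N + 3`, the first two reversed. The symbol `d` is the one the loop popped to see that the
list is nonempty; it is put back first. The argument `3 * n + 2 * m + 2` bounds the length of the
encoded triple, whose first two components are doubled by their blocks. -/
theorem run_foldProg_body [DecidableEq Γ] {N N₁ : ℕ} {p : Prog Γ} {P : Polynomial ℕ}
    {step : γ × (β × α) → β} (hN : N₁ ≤ N) (hp : Computes p N₁ P step) {s : ℕ → List Γ}
    (h0 : ∀ i, 0 < i → i < N + 6 → s i = []) (c : γ) (b : β) (a : α) (v r : List Γ) {d : Γ}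
    (hv : d :: v = block (enc a) ++ r) {n m : ℕ} (hc : (enc c : List Γ).length ≤ n)
    (ha : (enc a : List Γ).length ≤ n) (hb : (enc b : List Γ).length ≤ m)
    (hb' : (enc (step (c, b, a)) : List Γ).length ≤ m) :
    ∃ t ≤ 13 * n + 5 * m + 11 + P.eval (3 * n + 2 * m + 2),
      Run (.seq (.push (N + 3) d) <| .seq (.unblock (N + 3) (N + 4)) <| .seq (.move (N + 4) 0) <|
        .seq (.putBlock (N + 2) 0) <| .seq (.move (N + 1) (N + 4)) <|
        .seq (.dup (N + 4) (N + 1) (N + 5)) <| .seq (.putBlock (N + 5) 0) <|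
        .seq p (.move 0 (N + 2)))
        (frame N s [] (enc c : List Γ).reverse (enc b : List Γ).reverse v [] [])
        (frame N s [] (enc c : List Γ).reverse (enc (step (c, b, a)) : List Γ).reverse r [] []) t := by
  set C : List Γ := enc c with hC
  set B : List Γ := enc b with hB
  set A : List Γ := enc a with hA
  have r₁ : Run (.push (N + 3) d) (frame N s [] C.reverse B.reverse v [] [])
      (frame N s [] C.reverse B.reverse (block A ++ r) [] []) _ := Run.push.cast (by simp [hv]) rfl
  have r₂ : Run (.unblock (N + 3) (N + 4)) _ (frame N s [] C.reverse B.reverse r A.reverse []) _ :=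
    (run_unblock (s := frame N s [] C.reverse B.reverse (block A ++ r) [] []) (by omega)
      (by simp; rfl)).cast (by simp) rfl
  have r₃ : Run (.move (N + 4) 0) _ (frame N s A C.reverse B.reverse r [] []) _ :=
    (run_move (by omega) (frame N s [] C.reverse B.reverse r A.reverse [])).cast (by simp) rfl
  have r₄ : Run (.putBlock (N + 2) 0) _ (frame N s (block B ++ A) C.reverse [] r [] []) _ :=
    (run_putBlock (by omega) (frame N s A C.reverse B.reverse r [] [])).cast (by simp) rfl
  have r₅ : Run (.move (N + 1) (N + 4)) _ (frame N s (block B ++ A) [] [] r C []) _ :=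
    (run_move (by omega) (frame N s (block B ++ A) C.reverse [] r [] [])).cast (by simp) rfl
  have r₆ : Run (.dup (N + 4) (N + 1) (N + 5)) _
      (frame N s (block B ++ A) C.reverse [] r [] C.reverse) _ :=
    (run_dup (by omega) (by omega) (by omega) (frame N s (block B ++ A) [] [] r C [])).cast
      (by simp) rfl
  have r₇ : Run (.putBlock (N + 5) 0) _
      (frame N s (block C ++ (block B ++ A)) C.reverse [] r [] []) _ :=
    (run_putBlock (by omega) (frame N s (block B ++ A) C.reverse [] r [] C.reverse)).cast
      (by simp) rfl
  obtain ⟨t, ht, r₈⟩ := hp (c, b, a) (frame N s (block C ++ (block B ++ A)) C.reverse [] r [] [])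
    (by simp [enc_pair, hC, hB, hA]) fun i hi hi' => by
      rw [frame_of_lt _ _ _ _ _ _ hi (by omega), h0 i hi (by omega)]
  rw [update_frame_zero] at r₈
  have r₉ : Run (.move 0 (N + 2)) _
      (frame N s [] C.reverse (enc (step (c, b, a)) : List Γ).reverse r [] []) _ :=
    (run_move (by omega) (frame N s (enc (step (c, b, a))) C.reverse [] r [] [])).cast (by simp) rfl
  refine ⟨_, ?_, Run.seq r₁ (.seq r₂ (.seq r₃ (.seq r₄ (.seq r₅ (.seq r₆ (.seq r₇
    (.seq r₈ r₉)))))))⟩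
  have : t ≤ P.eval (3 * n + 2 * m + 2) := ht.trans (eval_le_eval P (by
    simp only [enc_pair, List.length_append, length_block, ← hC, ← hB, ← hA]; omega))
  simp
  omega

/-- Iterating a polynomial-time step can square the size each time, so a bound on all accumulators
has to be assumed. The map `φ` allows the bound to be required only for those triples that come from
a smaller type `δ` of inputs. -/
theorem foldl_of_enc_eq [DecidableEq Γ] {step : γ × (β × α) → β} (hstep : PolyTime Γ step)
    (φ : δ → γ × (β × List α)) (hφ : ∀ x, (enc x : List Γ) = enc (φ x)) {bound : Polynomial ℕ}
    (hbound : ∀ x l', l' <+: (φ x).2.2 →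
      (enc (l'.foldl (fun b a => step ((φ x).1, b, a)) (φ x).2.1) : List Γ).length ≤
        bound.eval (enc x : List Γ).length) :
    PolyTime Γ fun x => (φ x).2.2.foldl (fun b a => step ((φ x).1, b, a)) (φ x).2.1 := by
  obtain ⟨p, N, P, hN, hp, hP⟩ := hstep
  refine ⟨foldProg N p, N + 6, 12 * Polynomial.X + 20 + 2 * bound + Polynomial.X *
    (13 * Polynomial.X + 5 * bound + 12 + P.comp (3 * Polynomial.X + 2 * bound + 2)), by omega, ?_,
    fun x s hs h0 => ?_⟩
  · have hp' := hp.mono (show N ≤ N + 6 by omega)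
    have hu : ∀ i j, i < N + 6 → j < N + 6 → (Prog.unblock i j : Prog Γ).UsesBelow (N + 6) :=
      fun i j hi hj => ⟨hi, fun _ => ⟨hi, fun o => by cases o; exacts [trivial, hj]⟩⟩
    simp [foldProg, Prog.UsesBelow, Prog.dup, Prog.move, Prog.putBlock, Prog.clear, hp', hu]
  replace hbound := hbound x
  beta_reduce
  rw [hφ] at hs hbound ⊢
  generalize φ x = y at hs hbound ⊢
  obtain ⟨c, b, l⟩ := y
  dsimp only at hbound ⊢
  set n := (enc (c, b, l) : List Γ).length with hn
  set m := bound.eval n with hm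
  have hn' : n = 2 * (enc c : List Γ).length + 1 + (2 * (enc b : List Γ).length + 1 +
      (enc l : List Γ).length) := by simp [hn, enc_pair]
  have hl := length_le_length_enc (Γ := Γ) l
  have main : ∀ (l : List α) (b : β), (∀ a ∈ l, (enc a : List Γ).length ≤ n) →
      (∀ l', l' <+: l → (enc (l'.foldl (fun b a => step (c, b, a)) b) : List Γ).length ≤ m) →
      ∃ t ≤ l.length * (13 * n + 5 * m + 12 + P.eval (3 * n + 2 * m + 2)) + 1,
        Run (.loop (N + 3) (fun _ => false) fun a =>
          .seq (.push (N + 3) a) <| .seq (.unblock (N + 3) (N + 4)) <| .seq (.move (N + 4) 0) <|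
          .seq (.putBlock (N + 2) 0) <| .seq (.move (N + 1) (N + 4)) <|
          .seq (.dup (N + 4) (N + 1) (N + 5)) <| .seq (.putBlock (N + 5) 0) <|
          .seq p (.move 0 (N + 2)))
          (frame N s [] (enc c : List Γ).reverse (enc b : List Γ).reverse (enc l) [] [])
          (frame N s [] (enc c : List Γ).reverse
            (enc (l.foldl (fun b a => step (c, b, a)) b) : List Γ).reverse [] [] []) t := by
    intro l
    induction l with
    | nil => exact fun b _ _ => ⟨1, by simp, Run.loop_nil (by simp [enc_nil])⟩
    | cons a l ih =>
      intro b hl hb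
      -- Even an empty word has a nonempty block, so the loop sees that an item is left.
      obtain ⟨d, v, hv⟩ : ∃ d v, d :: v = block (enc a : List Γ) ++ enc l := by
        cases (enc a : List Γ) <;> exact ⟨_, _, rfl⟩
      obtain ⟨t₁, ht₁, r₁⟩ := run_foldProg_body le_rfl hP h0 c b a v (enc l) hv
        (n := n) (m := m) (by omega) (hl a (by simp)) (hb [] (by simp)) (hb [a] (List.prefix_cons_inj a |>.2 List.nil_prefix))
      obtain ⟨t₂, ht₂, r₂⟩ := ih (step (c, b, a)) (fun a ha => hl a (by simp [ha]))
        fun l' h => hb (a :: l') (List.prefix_cons_inj a |>.2 h)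
      refine ⟨t₁ + t₂ + 1, ?_, Run.loop_cons (a := d) (w := v) (by simp [enc_cons, hv]) rfl
        (by simpa using r₁) r₂⟩
      simp only [List.length_cons, add_mul]
      omega
  obtain ⟨t, ht, r₅⟩ := main l b (fun a ha => (length_enc_le_of_mem ha).trans (by omega))
    fun l' h => hbound l' h
  have hs' := eq_frame h0
  rw [hs] at hs'
  rw [hs']
  have r₁ : Run (.unblock 0 (N + 1)) (frame N s (enc (c, b, l)) [] [] [] [] [])
      (frame N s (enc (b, l)) (enc c : List Γ).reverse [] [] [] []) _ :=
    (run_unblock (by omega) ((frame_zero ..).trans (enc_pair _ _))).cast (by simp) rfl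
  have r₂ : Run (.unblock 0 (N + 2)) _
      (frame N s (enc l) (enc c : List Γ).reverse (enc b : List Γ).reverse [] [] []) _ :=
    (run_unblock (s := frame N s (enc (b, l)) (enc c : List Γ).reverse [] [] [] []) (by omega)
      ((frame_zero ..).trans (enc_pair _ _))).cast (by simp) rfl
  have r₃ : Run (.move 0 (N + 4)) _ (frame N s [] (enc c : List Γ).reverse
      (enc b : List Γ).reverse [] (enc l : List Γ).reverse []) _ :=
    (run_move (by omega) (frame N s (enc l) (enc c : List Γ).reverse
      (enc b : List Γ).reverse [] [] [])).cast (by simp) rfl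
  have r₄ : Run (.move (N + 4) (N + 3)) _ (frame N s [] (enc c : List Γ).reverse
      (enc b : List Γ).reverse (enc l) [] []) _ :=
    (run_move (by omega) (frame N s [] (enc c : List Γ).reverse
      (enc b : List Γ).reverse [] (enc l : List Γ).reverse [])).cast (by simp) rfl
  have r₆ : Run (.move (N + 2) 0) _ (frame N s (enc (l.foldl (fun b a => step (c, b, a)) b))
      (enc c : List Γ).reverse [] [] [] []) _ :=
    (run_move (by omega) (frame N s [] (enc c : List Γ).reverse
      (enc (l.foldl (fun b a => step (c, b, a)) b) : List Γ).reverse [] [] [])).cast (by simp) rfl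
  have r₇ := run_clear (N + 1) (frame N s (enc (l.foldl (fun b a => step (c, b, a)) b))
      (enc c : List Γ).reverse [] [] [] [])
  refine ⟨_, ?_, (Run.seq r₁ (.seq r₂ (.seq r₃ (.seq r₄ (.seq r₅ (.seq r₆ r₇)))))).cast ?_ rfl⟩
  · have h1 := hbound l (List.prefix_refl l)
    have h2 := Nat.mul_le_mul_right (13 * n + 5 * m + 12 + P.eval (3 * n + 2 * m + 2))
      (show l.length ≤ n by omega)
    simp [Polynomial.eval_comp, ← hm]
    omega
  · simp

end PolyTime

end StackProgram

/-! ### Branching, equality, and conversion between raw words and encoded lists. -/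

namespace StackProgram

open Function (update)
open Enc (enc enc_injective)

variable {Γ : Type}

theorem enc_symbol (a : Γ) : (enc a : List Γ) = [a] := rfl

/-- Register `1` collects a symbol per mismatch. It stays empty exactly if `u` is a prefix of `v`;
what remains of `v` then decides equality. -/
theorem run_eqProg_loop [DecidableEq Γ] (s : ℕ → List Γ) (u : List Γ) : ∀ v f : List Γ, ∃ f',
    f'.length ≤ f.length + u.length ∧ (f' = [] ↔ f = [] ∧ u <+: v) ∧ ∃ t ≤ 4 * u.length + 1,
      Run (.loop 2 (fun _ => false) fun a => .pop 0 fun o =>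
        bif decide (o = some a) then .skip else .push 1 a)
        (frame 0 s v f u [] [] []) (frame 0 s (v.drop u.length) f' [] [] [] []) t := by
  induction u with
  | nil => exact fun v f => ⟨f, by simp, by simp, 1, by simp,
      (Run.loop_nil (frame_two 0 ..)).cast (by simp) rfl⟩
  | cons a u ih =>
    intro v f
    have h0 : ∀ w, update (frame 0 s v f (a :: u) [] [] []) 2 w = frame 0 s v f w [] [] [] :=
      fun w => update_frame_two 0 ..
    have hf : ∀ v f u w, update (frame 0 s v f u [] [] []) 1 w = frame 0 s v w u [] [] [] :=
      fun _ _ _ _ => update_frame_one 0 ..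
    have hf' : ∀ v f u, frame 0 s v f u [] [] [] 1 = f :=
      fun _ _ _ => frame_one 0 ..
    by_cases h : v.head? = some a
    · obtain ⟨v, rfl⟩ : ∃ v', v = a :: v' := by
        cases v <;> simp_all
      obtain ⟨f', h₁, h₂, t, ht, hr⟩ := ih v f
      refine ⟨f', by simp; omega, by rw [h₂, List.prefix_cons_inj], 2 + t + 1, by simp; omega,
        Run.loop_cons (frame_two 0 ..) rfl (.pop (t := 1) ?_) (by simpa using hr)⟩
      simp only [h0, frame_zero, List.head?_cons, decide_true, cond_true, update_frame_zero,
        List.tail_cons]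
      exact .skip
    · obtain ⟨f', h₁, h₂, t, ht, hr⟩ := ih v.tail (a :: f)
      refine ⟨f', by simp at h₁ ⊢; omega, ?_, 2 + t + 1, by simp; omega,
        Run.loop_cons (frame_two 0 ..) rfl (.pop (t := 1) ?_) (by simpa using hr)⟩
      · rw [h₂]
        cases v <;> simp_all [List.cons_prefix_cons, eq_comm]
      · simp only [h0, frame_zero, h, decide_false, cond_false, update_frame_zero]
        exact Run.push.cast (by rw [hf, hf']) rfl

variable [Marked Γ]

theorem enc_bool (b : Bool) : (enc b : List Γ) = if b then [Marked.more] else [] := rfl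

namespace PolyTime

variable {α β γ δ : Type*} [Enc Γ α] [Enc Γ β] [Enc Γ γ] [Enc Γ δ]

/-- A nonempty list and the pair of its head and tail have the same encoding. It suffices to test
for emptiness by popping one symbol and pushing it back. -/
theorem listCase {h : α × List α → β} (hh : PolyTime Γ h) (b : β) :
    PolyTime Γ fun l : List α => match l with
      | [] => b
      | a :: l => h (a, l) := by
  obtain ⟨q, M, Q, hM, hq, hQ⟩ := PolyTime.const (Γ := Γ) (α := List α) b
  obtain ⟨p, N, P, hN, hp, hP⟩ := hh
  refine ⟨.pop 0 fun o => match o with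
    | none => q
    | some a => .seq (.push 0 a) p, max N M, Q + P + 2, by omega, ⟨by omega, fun o => ?_⟩,
    fun l s hs h0 => ?_⟩
  · cases o
    · exact hq.mono (le_max_right _ _)
    · exact ⟨by show 0 < max N M; omega, hp.mono (le_max_left _ _)⟩
  · cases l with
    | nil =>
      obtain ⟨t, ht, hr⟩ := hQ [] s hs fun i hi hi' => h0 i hi (by omega)
      rw [enc_nil] at hs ht
      refine ⟨t + 1, ?_, .pop ?_⟩
      · simp only [enc_nil, Polynomial.eval_add, Polynomial.eval_ofNat]
        omega
      · have : update s 0 [] = s := by rw [← hs, Function.update_eq_self]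
        simpa [hs, this] using hr
    | cons a l =>
      obtain ⟨t, ht, hr⟩ := hP (a, l) s hs fun i hi hi' => h0 i hi (by omega)
      obtain ⟨d, v, hv⟩ : ∃ d v, s 0 = d :: v := by
        rw [hs, enc_cons]
        cases (enc a : List Γ) <;> exact ⟨_, _, rfl⟩
      refine ⟨1 + t + 1, ?_, .pop ?_⟩
      · rw [enc_pair, ← enc_cons] at ht
        simp only [Polynomial.eval_add, Polynomial.eval_ofNat]
        omega
      · simp only [hv, List.head?_cons, List.tail_cons]
        refine .seq .push ?_
        have : update (update s 0 v) 0 (d :: update s 0 v 0) = s := by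
          rw [Function.update_idem, Function.update_self, ← hv, Function.update_eq_self]
        rwa [this]

theorem ite [DecidableEq Γ] {b : α → Bool} {f g : α → β} (hb : PolyTime Γ b) (hf : PolyTime Γ f)
    (hg : PolyTime Γ g) : PolyTime Γ fun x => bif b x then f x else g x := by
  suffices h : PolyTime Γ fun y : Bool × α => bif y.1 then f y.2 else g y.2 from
    h.comp (hb.pair .id)
  obtain ⟨p, N, P, hN, hp, hP⟩ := hf
  obtain ⟨q, M, Q, hM, hq, hQ⟩ := hg
  -- The pair with `false` begins with `last`, the empty block; the pair with `true` begins with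
  -- `more`, `more`, `last`. One symbol decides, and in the second case two more are discarded.
  refine ⟨.pop 0 fun o => bif decide (o = some Marked.last) then q else
    .seq (.pop 0 fun _ => .skip) (.seq (.pop 0 fun _ => .skip) p), max N M, Q + P + 10,
    by omega, ⟨by omega, fun o => ?_⟩, ?_⟩
  · have : 0 < max N M := lt_max_of_lt_left hN
    beta_reduce
    cases decide (o = some Marked.last)
    · exact ⟨⟨this, fun _ => trivial⟩, ⟨this, fun _ => trivial⟩, hp.mono (le_max_left _ _)⟩
    · exact hq.mono (le_max_right _ _)
  · rintro ⟨b, x⟩ s hs h0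
    cases b
    · obtain ⟨t, ht, hr⟩ := hQ x (update s 0 (enc x)) (by simp)
        fun i hi hi' => by simp [hi.ne', h0 i hi (by omega)]
      have hs' : s 0 = Marked.last :: enc x := hs
      refine ⟨t + 1, ?_, .pop ?_⟩
      · have := eval_le_eval Q (show (enc x : List Γ).length ≤ (enc (false, x) : List Γ).length by
          simp [enc_pair])
        simp
        omega
      · simpa [hs'] using hr
    · obtain ⟨t, ht, hr⟩ := hP x (update s 0 (enc x)) (by simp)
        fun i hi hi' => by simp [hi.ne', h0 i hi (by omega)]
      have hs' : s 0 = Marked.more :: Marked.more :: Marked.last :: enc x := hs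
      refine ⟨_, ?_, .pop ((?_ : Run _ _ _ ((1 + 1) + ((1 + 1) + t))))⟩
      · have := eval_le_eval P (show (enc x : List Γ).length ≤ (enc (true, x) : List Γ).length by
          simp [enc_pair])
        simp
        omega
      · simp only [hs', List.head?_cons, List.tail_cons, Option.some.injEq,
          Marked.more_ne_last, decide_false, cond_false]
        exact .seq (.pop .skip) (.seq (.pop .skip) (by simpa using hr))

/-- Program comparing the two components of a pair. -/
def eqProg [DecidableEq Γ] : Prog Γ :=
  .seq (.unblock 0 1) <| .seq (.move 1 2) <|
  .seq (.loop 2 (fun _ => false) fun a => .pop 0 fun o =>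
    bif decide (o = some a) then .skip else .push 1 a) <|
  .seq (.loop 0 (fun _ => false) fun a => .push 1 a) <|
  .pop 1 fun o => bif o.isNone then .push 0 Marked.more else .clear 1

theorem eq [DecidableEq Γ] [DecidableEq α] : PolyTime Γ fun x : α × α => decide (x.1 = x.2) := by
  refine ⟨eqProg, 6, 20 * Polynomial.X + 20, by simp, ?_, fun x s hs h0 => ?_⟩
  · have hu : (Prog.unblock 0 1 : Prog Γ).UsesBelow 6 :=
      ⟨by simp, fun _ => ⟨by simp, fun o => by cases o <;> simp [Prog.UsesBelow]⟩⟩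
    refine ⟨hu, ⟨by simp, fun _ => by simp [Prog.UsesBelow]⟩,
      ⟨by simp, fun _ => ⟨by simp, fun o => ?_⟩⟩, ⟨by simp, fun _ => by simp [Prog.UsesBelow]⟩,
      ⟨by simp, fun o => ?_⟩⟩
    · beta_reduce
      cases decide (o = some _) <;> simp [Prog.UsesBelow]
    · cases o <;> simp [Prog.UsesBelow, Prog.clear]
  have hs' := eq_frame_zero h0
  rw [hs] at hs'
  rw [hs']
  obtain ⟨x, y⟩ := x
  set u : List Γ := enc x with hu
  set v : List Γ := enc y with hv
  have r₁ : Run (.unblock 0 1) (frame 0 s (enc (x, y)) [] [] [] [] [])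
      (frame 0 s v u.reverse [] [] [] []) _ :=
    (run_unblock (by omega) ((frame_zero 0 ..).trans (enc_pair _ _))).cast
      (by rw [update_frame_zero, frame_one 0]; exact (update_frame_one 0 ..).trans (by simp; rfl)) rfl
  have r₂ : Run (.move 1 2) _ (frame 0 s v [] u [] [] []) _ :=
    (run_move (by omega) (frame 0 s v u.reverse [] [] [] [])).cast
      (by rw [frame_one 0, frame_two 0, update_frame_one 0]
          exact (update_frame_two 0 ..).trans (by simp)) rfl
  obtain ⟨f, hf, hf', t, ht, r₃⟩ := run_eqProg_loop s u v []
  have r₄ : Run (.move 0 1) _ (frame 0 s [] ((v.drop u.length).reverse ++ f) [] [] [] []) _ :=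
    (run_move (by omega) (frame 0 s (v.drop u.length) f [] [] [] [])).cast
      (by rw [frame_zero, frame_one 0, update_frame_zero]; exact update_frame_one 0 ..) rfl
  -- Equality of words is prefix plus nothing left over, and encodings are injective.
  have key : ((v.drop u.length).reverse ++ f = []) ↔ x = y := by
    rw [List.append_eq_nil_iff, List.reverse_eq_nil_iff, hf', List.drop_eq_nil_iff]
    constructor
    · rintro ⟨h₁, -, h₂⟩
      exact enc_injective (h₂.eq_of_length (le_antisymm h₂.length_le h₁))
    · intro h
      rw [hu, hv, h]
      exact ⟨le_rfl, rfl, List.prefix_refl _⟩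
  have r₅ : ∃ t' ≤ 2 * (v.length + f.length) + 2, Run (.pop 1 fun o => bif o.isNone then
      .push 0 Marked.more else .clear 1)
      (frame 0 s [] ((v.drop u.length).reverse ++ f) [] [] [] [])
      (frame 0 s (enc (decide (x = y))) [] [] [] [] []) t' := by
    by_cases h : x = y
    · rw [key.2 h]
      refine ⟨1 + 1, by omega, .pop ?_⟩
      rw [frame_one 0]
      exact Run.push.cast (by rw [List.tail_nil, update_frame_one 0]; simp [enc_bool, h]) rfl
    · have h' := mt key.1 h
      obtain ⟨d, w, hw⟩ := List.exists_cons_of_ne_nil h'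
      have hl := congrArg List.length hw
      simp only [List.length_append, List.length_reverse, List.length_drop, List.length_cons] at hl
      refine ⟨2 * w.length + 1 + 1, by omega, .pop ?_⟩
      rw [hw, frame_one 0, update_frame_one 0]
      exact (run_clear 1 _).cast (by rw [update_frame_one 0]; simp [enc_bool, h])
        (by rw [frame_one 0]; rfl)
  obtain ⟨t', ht', r₅⟩ := r₅
  refine ⟨_, ?_, (Run.seq r₁ (.seq r₂ (.seq r₃ (.seq r₄ r₅)))).cast (by simp) rfl⟩
  have e1 : frame 0 s v u.reverse [] [] [] [] 1 = u.reverse := frame_one 0 ..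
  rw [e1]
  simp [enc_pair, ← hu, ← hv] at hf ⊢
  omega

/-- Conversion of a raw word to an encoded list of symbols. -/
def explodeProg : Prog Γ :=
  .seq (.move 0 1) <| .loop 1 (fun _ => false) fun a =>
    .seq (.push 0 Marked.last) <| .seq (.push 0 a) (.push 0 Marked.more)

/-- Conversion of an encoded list of symbols to a raw word. -/
def implodeProg : Prog Γ :=
  .seq (.loop 0 (fun _ => false) fun _ => .seq (.pop 0 fun o => match o with
    | none => .skip
    | some a => .push 1 a) (.pop 0 fun _ => .skip)) (.move 1 0)

/-- In the encoding of a word as a list of symbols each `a` becomes `more`, `a`, `last`. The symbols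
are pushed in the opposite order. -/
theorem run_explodeProg (w : List Γ) :
    Run explodeProg (update (fun _ => []) 0 w) (update (fun _ => []) 0 (enc w))
      (6 * w.length + 2) := by
  have main : ∀ (w v : List Γ), Run (.loop 1 (fun _ => false) fun a =>
      .seq (.push 0 Marked.last) <| .seq (.push 0 a) (.push 0 Marked.more))
      (update (update (fun _ => []) 0 (enc v)) 1 w)
      (update (fun _ => []) 0 (enc (w.reverse ++ v))) (4 * w.length + 1) := by
    intro w
    induction w with
    | nil =>
      refine fun v => (Run.loop_nil (by simp)).cast ?_ rfl
      rw [Function.update_eq_self_iff.2 (by simp)]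
      rfl
    | cons a w ih =>
      intro v
      refine (Run.loop_cons (s' := update (update (fun _ => []) 0 (enc (a :: v))) 1 w)
        (a := a) (w := w) (t := 1 + (1 + 1)) (by simp) rfl ?_ (ih (a :: v))).cast (by simp)
        (by simp; ring)
      refine (Run.seq .push (.seq .push .push)).cast ?_ rfl
      funext n
      simp only [Function.update_apply]
      split_ifs <;> simp_all [enc_cons, enc_symbol, block]
  have h := main w.reverse []
  simp only [List.reverse_reverse, List.append_nil, List.length_reverse] at h
  refine (Run.seq ((run_move (by simp) _).cast ?_ rfl) h).cast rfl (by simp; ring)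
  funext n
  simp only [Function.update_apply]
  split_ifs <;> simp_all [enc_nil]

theorem run_implodeProg (w : List Γ) :
    Run implodeProg (update (fun _ => []) 0 (enc w)) (update (fun _ => []) 0 w)
      (7 * w.length + 2) := by
  have main : ∀ (w v : List Γ), Run (.loop 0 (fun _ => false) fun _ => .seq (.pop 0 fun o =>
      match o with
      | none => .skip
      | some a => .push 1 a) (.pop 0 fun _ => .skip))
      (update (update (fun _ => []) 1 v) 0 (enc w))
      (update (fun _ => []) 1 (w.reverse ++ v)) (5 * w.length + 1) := by
    intro w
    induction w with
    | nil =>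
      refine fun v => (Run.loop_nil (by simp [enc_nil])).cast ?_ rfl
      rw [Function.update_eq_self_iff.2 (by simp [enc_nil])]
      rfl
    | cons a w ih =>
      intro v
      have hs : update (update (fun _ => []) 1 v) 0 (enc (a :: w)) 0 =
        Marked.more :: a :: Marked.last :: enc w := by simp [enc_cons, enc_symbol, block]
      refine (Run.loop_cons (t := 1 + 1 + (1 + 1)) hs rfl (.seq (.pop
        (s' := update (update (fun _ => []) 1 (a :: v)) 0 (Marked.last :: enc w)) ?_)
        (.pop .skip)) ?_ (t' := 5 * w.length + 1)).cast rfl (by simp; ring)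
      · simp only [Function.update_self, List.head?_cons, List.tail_cons]
        refine Run.push.cast ?_ rfl
        funext n
        simp only [Function.update_apply]
        split_ifs <;> simp_all
      · simpa using ih (a :: v)
  have h := main w []
  rw [Function.update_eq_self_iff.2 rfl] at h
  refine (Run.seq h (run_move (by simp) _)).cast ?_ (by simp; ring)
  funext n
  simp only [Function.update_apply]
  split_ifs <;> simp_all

end PolyTime

end StackProgram

/-! ### From polynomial-time programs to machines, and closure properties of `PolyTime`. -/

namespace StackProgram

open Function (update)
open Enc (enc enc_injective)

variable {Γ : Type} [Marked Γ]

theorem length_enc_symbols (w : List Γ) : (enc w : List Γ).length = 3 * w.length := by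
  induction w with
  | nil => rfl
  | cons a w ih => simp [enc_cons, enc_symbol, ih]; ring

/-- Functions on words that stack programs compute in polynomial time are computed in polynomial
time by Turing machines. -/
theorem PolyTime.tm2ComputableInPolyTime [Fintype Γ] {F : List Γ → List Γ} (hF : PolyTime Γ F)
    {α β : Type} {ea : α → List Γ} {eb : β → List Γ} {f : α → β} (h : ∀ a, F (ea a) = eb (f a)) :
    Nonempty (Turing.TM2ComputableInPolyTime ea eb f) := by
  obtain ⟨B, hB⟩ := hF.exists_length_le
  obtain ⟨p, N, P, hN, hp, hP⟩ := hF
  let q : Prog Γ := .seq explodeProg (.seq p implodeProg)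
  -- Time for unpacking, for `p`, for packing and for halting. The argument `3 * X` appears because
  -- encoded words are three times as long; `B` bounds the output.
  let T : Polynomial ℕ := 6 * Polynomial.X + 5 + P.comp (3 * Polynomial.X) +
    7 * B.comp (3 * Polynomial.X)
  have hq : q.UsesBelow (N + 2 + 1) := by
    refine ⟨?_, hp.mono (by omega), ?_⟩
    · simp [explodeProg, Prog.UsesBelow, Prog.move]
    · simp [implodeProg, Prog.UsesBelow, Prog.move]
      intro _ o
      cases o <;> simp [Prog.UsesBelow]
  have out : ∀ (a : α) (w w' : List Γ), w = ea a → w' = eb (f a) →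
      Nonempty (Turing.TM2OutputsInTime (q.machine (N + 2)) w (some w')
        (T.eval (ea a).length)) := by
    rintro a _ _ rfl rfl
    obtain ⟨t, ht, hr⟩ := hP (ea a) (update (fun _ => []) 0 (enc (ea a))) (by simp)
      fun i hi _ => by simp [hi.ne']
    rw [Function.update_idem, h] at hr
    obtain ⟨hm⟩ := Prog.machine_outputs hq
      (.seq (run_explodeProg (ea a)) (.seq hr (run_implodeProg (eb (f a)))))
    refine ⟨⟨hm.toEvalsTo, hm.steps_le_m.trans ?_⟩⟩
    have h₁ := hB (ea a)
    rw [h, length_enc_symbols, length_enc_symbols] at h₁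
    rw [length_enc_symbols] at ht
    simp [T, Polynomial.eval_comp]
    omega
  exact ⟨{
    tm := q.machine (N + 2)
    inputAlphabet := Equiv.refl Γ
    outputAlphabet := Equiv.refl Γ
    time := T
    outputsFun := fun a => (out a _ _ (List.map_id _) (List.map_id _)).some }⟩

namespace PolyTime

variable {α β γ δ : Type*} [Enc Γ α] [Enc Γ β] [Enc Γ γ] [Enc Γ δ]

theorem congr_enc {f : α → β} {g : α → γ} (hg : PolyTime Γ g)
    (h : ∀ x, (enc (f x) : List Γ) = enc (g x)) : PolyTime Γ f := by
  obtain ⟨p, N, P, hN, hp, hP⟩ := hg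
  refine ⟨p, N, P, hN, hp, fun x s hs h0 => ?_⟩
  rw [h]
  exact hP x s hs h0

theorem cons {f : α → β} {g : α → List β} (hf : PolyTime Γ f) (hg : PolyTime Γ g) :
    PolyTime Γ fun x => f x :: g x :=
  (hf.pair hg).congr_enc fun _ => rfl

theorem isEmpty {f : α → List β} (hf : PolyTime Γ f) : PolyTime Γ fun x => (f x).isEmpty :=
  ((listCase (const false) true).comp hf).congr_enc fun x => by cases f x <;> rfl

theorem ofFn {n : ℕ} {f : Fin n → α → β} (hf : ∀ i, PolyTime Γ (f i)) :
    PolyTime Γ fun x => List.ofFn fun i => f i x := by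
  induction n with
  | zero => exact (const []).congr_enc fun x => rfl
  | succ n ih =>
    refine ((hf 0).cons (ih fun i => hf i.succ)).congr_enc fun x => ?_
    rw [List.ofFn_succ]

theorem length_enc_reverse (l : List α) : (enc l.reverse : List Γ).length =
    (enc l : List Γ).length := by
  induction l with
  | nil => rfl
  | cons a l ih =>
    simp only [List.reverse_cons, enc_append, enc_cons, enc_nil, List.length_append, ih,
      List.length_nil]
    omega

theorem length_enc_flatMap_le {ι : Type*} {g : ι → List β} {l : List ι} {m : ℕ}
    (h : ∀ a ∈ l, (enc (g a) : List Γ).length ≤ m) :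
    (enc (l.flatMap g) : List Γ).length ≤ l.length * m := by
  induction l with
  | nil => simp [enc_nil]
  | cons a l ih =>
    have h₁ := h a (by simp)
    have h₂ := ih fun a ha => h a (by simp [ha])
    simp only [List.flatMap_cons, enc_append, List.length_append, List.length_cons, add_mul]
    omega

variable [DecidableEq Γ]

theorem append' {f g : α → List β} (hf : PolyTime Γ f) (hg : PolyTime Γ g) :
    PolyTime Γ fun x => f x ++ g x :=
  append.comp (hf.pair hg)

theorem not {f : α → Bool} (hf : PolyTime Γ f) : PolyTime Γ fun x => !f x :=
  (ite hf (const false) (const true)).congr_enc fun x => by cases f x <;> rfl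

theorem and {f g : α → Bool} (hf : PolyTime Γ f) (hg : PolyTime Γ g) :
    PolyTime Γ fun x => f x && g x :=
  (ite hf hg (const false)).congr_enc fun x => by cases f x <;> rfl

theorem or {f g : α → Bool} (hf : PolyTime Γ f) (hg : PolyTime Γ g) :
    PolyTime Γ fun x => f x || g x :=
  (ite hf (const true) hg).congr_enc fun x => by cases f x <;> rfl

theorem decide_eq [DecidableEq β] {f g : α → β} (hf : PolyTime Γ f) (hg : PolyTime Γ g) :
    PolyTime Γ fun x => decide (f x = g x) :=
  eq.comp (hf.pair hg)

theorem headD {f : α → List β} (hf : PolyTime Γ f) (b : β) : PolyTime Γ fun x => (f x).headD b :=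
  ((listCase fst b).comp hf).congr_enc fun x => by cases f x <;> rfl

theorem tail {f : α → List β} (hf : PolyTime Γ f) : PolyTime Γ fun x => (f x).tail :=
  ((listCase snd []).comp hf).congr_enc fun x => by cases f x <;> rfl

theorem getD {f : α → List β} (hf : PolyTime Γ f) (i : ℕ) (b : β) :
    PolyTime Γ fun x => (f x).getD i b := by
  induction i generalizing f with
  | zero => exact (hf.headD b).congr_enc fun x => by cases f x <;> rfl
  | succ i ih => exact (ih hf.tail).congr_enc fun x => by cases f x <;> rfl

/-- A fold with accumulators of polynomially bounded size. -/
theorem foldl {step : γ → β → α → β} {b : γ → β} {l : γ → List α}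
    (hstep : PolyTime Γ fun y : γ × (β × α) => step y.1 y.2.1 y.2.2)
    (hb : PolyTime Γ b) (hl : PolyTime Γ l) {bound : Polynomial ℕ}
    (h : ∀ x l', l' <+: l x →
      (enc (l'.foldl (step x) (b x)) : List Γ).length ≤ bound.eval (enc x : List Γ).length) :
    PolyTime Γ fun x => (l x).foldl (step x) (b x) := by
  -- The size bound is known only for triples that arise from some `x`, so the fold is restricted to
  -- these.
  let ω := {y : γ × (β × List α) // ∃ x, y = (x, b x, l x)}
  let _ : Enc Γ ω := ⟨fun y => enc y.1, fun _ _ h => Subtype.ext (enc_injective h)⟩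
  have h₁ : PolyTime Γ fun x => (⟨(x, b x, l x), x, rfl⟩ : ω) :=
    (PolyTime.id.pair (hb.pair hl)).congr_enc fun _ => rfl
  refine (foldl_of_enc_eq hstep (fun y : ω => y.1) (fun _ => rfl) (bound := bound) ?_).comp h₁
  rintro ⟨_, x, rfl⟩ l' hl'
  refine (h x l' hl').trans (eval_le_eval _ ?_)
  show _ ≤ (enc (x, b x, l x) : List Γ).length
  simp [enc_pair]
  omega

/-- A fold whose accumulators are the results for prefixes of the list: at most `L` items, each
contributing a polynomially long word. -/
theorem flatMap {l : γ → List α} {g : γ → α → List β} (hl : PolyTime Γ l)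
    (hg : PolyTime Γ fun y : γ × α => g y.1 y.2) :
    PolyTime Γ fun x => (l x).flatMap (g x) := by
  obtain ⟨L, hL⟩ := hl.exists_length_le
  obtain ⟨G, hG⟩ := hg.exists_length_le
  have key : ∀ (x : γ) (l : List α) (b : List β),
      l.foldl (fun b a => b ++ g x a) b = b ++ l.flatMap (g x) := by
    intro x l
    induction l with
    | nil => simp
    | cons a l ih => simp [ih]
  have := foldl (Γ := Γ) (step := fun x b a => b ++ g x a) (b := fun _ : γ => ([] : List β))
    (append' (fst.comp snd) (hg.comp (fst.pair (snd.comp snd)))) (const []) hl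
    (bound := L * G.comp (2 * Polynomial.X + 1 + L)) fun x l' hl' => by
      rw [key, List.nil_append]
      have h₁ : l'.length ≤ L.eval (enc x : List Γ).length :=
        (hl'.length_le.trans (length_le_length_enc _)).trans (hL x)
      refine (length_enc_flatMap_le (m := G.eval (2 * (enc x : List Γ).length + 1 +
        L.eval (enc x : List Γ).length)) fun a ha => ?_).trans ?_
      · refine (hG (x, a)).trans (eval_le_eval _ ?_)
        have := (length_enc_le_of_mem (Γ := Γ) (hl'.subset ha)).trans (hL x)
        simp only [enc_pair, List.length_append, length_block]
        omega
      · simpa [Polynomial.eval_comp] using Nat.mul_le_mul_right _ h₁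
  exact this.congr_enc fun x => by rw [key, List.nil_append]

theorem flatten {l : γ → List (List α)} (hl : PolyTime Γ l) : PolyTime Γ fun x => (l x).flatten :=
  (hl.flatMap (g := fun _ a => a) snd).congr_enc fun x => by rw [List.flatMap_id']

theorem map {l : γ → List α} {g : γ → α → β} (hl : PolyTime Γ l)
    (hg : PolyTime Γ fun y : γ × α => g y.1 y.2) : PolyTime Γ fun x => (l x).map (g x) :=
  (hl.flatMap (g := fun x a => [g x a]) (hg.cons (const []))).congr_enc fun x => by
    rw [List.map_eq_flatMap]

theorem filter {l : γ → List α} {p : γ → α → Bool} (hl : PolyTime Γ l)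
    (hp : PolyTime Γ fun y : γ × α => p y.1 y.2) : PolyTime Γ fun x => (l x).filter (p x) :=
  (hl.flatMap (g := fun x a => bif p x a then [a] else [])
    (ite hp (snd.cons (const [])) (const []))).congr_enc fun x => by
      congr 1
      induction l x with
      | nil => rfl
      | cons a l ih =>
        rw [List.filter_cons, ih, List.flatMap_cons]
        cases p x a <;> rfl

theorem any {l : γ → List α} {p : γ → α → Bool} (hl : PolyTime Γ l)
    (hp : PolyTime Γ fun y : γ × α => p y.1 y.2) : PolyTime Γ fun x => (l x).any (p x) :=
  (hl.filter hp).isEmpty.not.congr_enc fun x => by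
    congr 1
    induction l x with
    | nil => rfl
    | cons a l ih => cases h : p x a <;> simp [h, ih]

theorem all {l : γ → List α} {p : γ → α → Bool} (hl : PolyTime Γ l)
    (hp : PolyTime Γ fun y : γ × α => p y.1 y.2) : PolyTime Γ fun x => (l x).all (p x) :=
  (hl.any hp.not).not.congr_enc fun x => by
    rw [List.all_eq_not_any_not]

theorem decide_mem [DecidableEq β] {f : α → β} {l : α → List β} (hf : PolyTime Γ f)
    (hl : PolyTime Γ l) : PolyTime Γ fun x => decide (f x ∈ l x) :=
  (hl.any (p := fun x b => decide (f x = b)) ((hf.comp fst).decide_eq snd)).congr_enc fun x => by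
    congr 1
    induction l x with
    | nil => simp
    | cons a l ih => simp [ih, Bool.decide_or]

theorem flatMap_const {ι : Type*} {f : ι → α → List β} (is : List ι)
    (hf : ∀ i, PolyTime Γ (f i)) : PolyTime Γ fun x => is.flatMap fun i => f i x := by
  induction is with
  | nil => exact const []
  | cons i is ih => exact ((hf i).append' ih).congr_enc fun x => by rw [List.flatMap_cons]

theorem any_const {ι : Type*} {f : ι → α → Bool} (is : List ι)
    (hf : ∀ i, PolyTime Γ (f i)) : PolyTime Γ fun x => is.any fun i => f i x := by
  induction is with
  | nil => exact const false
  | cons i is ih => exact ((hf i).or ih).congr_enc fun x => by rw [List.any_cons]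

theorem all_const {ι : Type*} {f : ι → α → Bool} (is : List ι)
    (hf : ∀ i, PolyTime Γ (f i)) : PolyTime Γ fun x => is.all fun i => f i x := by
  induction is with
  | nil => exact const true
  | cons i is ih => exact ((hf i).and ih).congr_enc fun x => by rw [List.all_cons]

theorem reverse {l : γ → List α} (hl : PolyTime Γ l) : PolyTime Γ fun x => (l x).reverse := by
  obtain ⟨L, hL⟩ := hl.exists_length_le
  have key : ∀ (l b : List α), l.foldl (fun b a => a :: b) b = l.reverse ++ b := by
    intro l
    induction l with
    | nil => simp
    | cons a l ih => simp [ih]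
  have := foldl (Γ := Γ) (step := fun _ b a => a :: b) (b := fun _ : γ => ([] : List α))
    ((snd.comp snd).cons (fst.comp snd)) (const []) hl (bound := L) fun x l' hl' => by
      rw [key, List.append_nil, length_enc_reverse]
      exact (length_enc_le_of_sublist hl'.sublist).trans (hL x)
  exact this.congr_enc fun x => by rw [key, List.append_nil]

/-- The alphabet is finite, so a chain of equality tests does it; the value at `Marked.more` is a
default that is never reached. -/
theorem symbolCase [Fintype Γ] {g : Γ → α → β} (hg : ∀ a, PolyTime Γ (g a)) :
    PolyTime Γ fun y : Γ × α => g y.1 y.2 := by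
  have key : ∀ as : List Γ, PolyTime Γ fun y : Γ × α => as.foldr
      (fun a b => bif decide (y.1 = a) then g a y.2 else b) (g Marked.more y.2) := by
    intro as
    induction as with
    | nil => exact (hg _).comp snd
    | cons a as ih => exact ite (fst.decide_eq (const a)) ((hg a).comp snd) ih
  refine (key Finset.univ.toList).congr_enc fun ⟨a, x⟩ => ?_
  congr 1
  have : ∀ as : List Γ, a ∈ as → g a x = as.foldr
      (fun a' b => bif decide (a = a') then g a' x else b) (g Marked.more x) := by
    intro as
    induction as with
    | nil => simp
    | cons a' as ih =>
      intro h
      by_cases h' : a = a'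
      · simp [h']
      · simpa [h'] using ih (by simpa [h'] using h)
  exact this _ (by simp)

end PolyTime

/-- Start from `X` and repeatedly filter the list `L` by a condition depending on the previous
result, as often as `L` is long. -/
def filterIter {α : Type*} (P : List α → α → Bool) (L X : List α) : List α :=
  L.foldl (fun Y _ => L.filter (P Y)) X

/-- Each iterate is the start list or a filter of `L`, hence no longer than `L` when encoded. No
bound on the growth under `P` is needed. -/
theorem PolyTime.filterIter [DecidableEq Γ] {α γ : Type*} [Enc Γ α] [Enc Γ γ] {L X : γ → List α}
    {P : γ → List α → α → Bool} (hP : PolyTime Γ fun y : (γ × List α) × α => P y.1.1 y.1.2 y.2)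
    (hL : PolyTime Γ L) (hX : PolyTime Γ X) (h : ∀ x, (X x).Sublist (L x)) :
    PolyTime Γ fun x => filterIter (P x) (L x) (X x) := by
  obtain ⟨B, hB⟩ := hL.exists_length_le
  refine foldl (step := fun x Y _ => (L x).filter (P x Y)) ?_ hX hL (bound := B) fun x l' _ => ?_
  · exact ((hL.comp fst).filter (p := fun y : γ × (List α × α) => P y.1 y.2.1)
      (hP.comp (((fst.comp fst).pair (fst.comp (snd.comp fst))).pair snd)))
  · refine (length_enc_le_of_sublist ?_).trans (hB x)
    rcases List.eq_nil_or_concat l' with rfl | ⟨l'', a, rfl⟩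
    · exact h x
    · rw [List.concat_eq_append, List.foldl_append]
      exact List.filter_sublist

end StackProgram

/-! ### The algorithm and its running time -/

namespace BlockchainDB

open StackProgram
open StackProgram.Enc (enc enc_injective)

variable {S : Schema}

instance : Marked (Symbol S) where
  more := .endTx
  last := .endList
  more_ne_last := by simp

instance : Enc (Symbol S) (Fin S.numRel) where
  enc r := [.rel r]
  enc_injective := fun _ _ h => by simpa using h

instance : Enc (Symbol S) (Fact S) where
  enc t := enc (t.1, List.ofFn t.2)
  enc_injective := by
    rintro ⟨r, t⟩ ⟨r', t'⟩ h
    have h' := enc_injective h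
    simp only [Prod.mk.injEq] at h'
    obtain ⟨rfl, h'⟩ := h'
    rw [List.ofFn_injective h']

/-- The constant of a ground tuple at a position, or the empty constant beyond the arity. -/
def constAt (t : Fact S) (i : ℕ) : Const := (List.ofFn t.2).getD i []

theorem constAt_mk (r : Fin S.numRel) (t : Fin (S.arity r) → Const) (i : Fin (S.arity r)) :
    constAt ⟨r, t⟩ i = t i := by
  simp [constAt]

/-- The ground tuple of relation `r` with the given constants. -/
def factOfList (r : Fin S.numRel) (l : List Const) : Fact S := ⟨r, fun j => l.getD j []⟩

theorem factOfList_ofFn (t : Fact S) : factOfList t.1 (List.ofFn t.2) = t := by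
  simp [factOfList]

/-- `X` holds the tuples that the dependencies `ics` demand for `t`. -/
def supported (ics : List (InclusionDependency S)) (X : List (Fact S)) (t : Fact S) : Bool :=
  ics.all fun d => !decide (t.1 = d.src) || X.any fun t' => decide (t'.1 = d.dst) &&
    (List.finRange d.width).all fun l => decide (constAt t (d.lhs l) = constAt t' (d.rhs l))

/-- `X` satisfies the dependencies `ics`. -/
def satisfies (ics : List (InclusionDependency S)) (X : List (Fact S)) : Bool :=
  X.all (supported ics X)

/-- All tuples of `T` are in `W`. -/
def contains (W T : List (Fact S)) : Bool := T.all fun t => decide (t ∈ W)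

/-- The transactions in `Ts` that are in the largest state reachable from `B`. -/
def appendable (ics : List (InclusionDependency S)) (Ts : List (List (Fact S)))
    (B : List (Fact S)) : List (List (Fact S)) :=
  filterIter (fun A T => satisfies ics (B ++ A.flatten ++ T)) Ts []

/-- The largest state reachable from `B` by appending transactions in `Ts`. -/
def largestWorld (ics : List (InclusionDependency S)) (Ts : List (List (Fact S)))
    (B : List (Fact S)) : List (Fact S) :=
  B ++ (appendable ics Ts B).flatten

/-- The largest part of `X` that can be appended to `M`. -/
def largestPart (ics : List (InclusionDependency S)) (M X : List (Fact S)) : List (Fact S) :=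
  filterIter (fun Y t => supported ics (M ++ Y) t) X X

/-- The constants of the tuples in `T`. -/
def constants (T : List (Fact S)) : List Const := T.flatMap fun t => List.ofFn t.2

/-- A constant longer than those in `T`. -/
def freshConst (T : List (Fact S)) : Const := (constants T).flatten ++ [true]

/-- All lists of length `n` over `dom`. -/
def tuples (dom : List Const) : ℕ → List (List Const)
  | 0 => [[]]
  | n + 1 => dom.flatMap fun c => (tuples dom n).map fun l => c :: l

/-- All ground tuples with constants in `dom`. -/
def groundTuples (dom : List Const) : List (Fact S) :=
  (List.finRange S.numRel).flatMap fun r => (tuples dom (S.arity r)).map fun l => factOfList r l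

/-- The tuple that `d` demands for `t`, with `c` at the undetermined positions. -/
noncomputable def demanded (d : InclusionDependency S) (c : Const) (t : Fact S) : Fact S :=
  ⟨d.dst, fun j => if h : ∃ l, d.rhs l = j then constAt t (d.lhs h.choose) else c⟩

/-- The closure of `B` under the demands of `ics`, with `c` at the undetermined positions. -/
noncomputable def chase (ics : List (InclusionDependency S)) (c : Const) (B : List (Fact S)) :
    List (Fact S) :=
  filterIter (fun X t => decide (t ∈ B) || X.any fun s => ics.any fun d =>
    decide (s.1 = d.src) && decide (t = demanded d c s)) (groundTuples (c :: constants B)) []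

/-- Drop `t` from `X` if the tuples in `G` can still be appended afterwards. -/
def dropIfPossible (ics : List (InclusionDependency S)) (Ts : List (List (Fact S)))
    (M G X : List (Fact S)) (t : Fact S) : List (Fact S) :=
  bif contains (largestWorld ics Ts
    (M ++ largestPart ics M (X.filter fun s => !decide (s = t)))) G
  then largestPart ics M (X.filter fun s => !decide (s = t)) else X

/-- Inputs: the state, the pending transactions, `Tin` and `Tout`. -/
abbrev RawInput (S : Schema) : Type :=
  List (Fact S) × (List (List (Fact S)) × (List (List (Fact S)) × List (List (Fact S))))

/-- The largest possible world. -/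
def RawInput.world (ics : List (InclusionDependency S)) (x : RawInput S) : List (Fact S) :=
  largestWorld ics x.2.1 x.1

/-- A separating transaction, if there is any. -/
noncomputable def RawInput.candidate (ics : List (InclusionDependency S)) (x : RawInput S) :
    List (Fact S) :=
  chase ics (freshConst x.2.1.flatten) x.2.2.1.flatten

/-- There is no separating transaction. -/
noncomputable def RawInput.infeasible (ics : List (InclusionDependency S)) (x : RawInput S) :
    Bool :=
  x.2.2.2.any fun T => contains (largestWorld ics x.2.1 (x.world ics ++ x.candidate ics)) T

/-- A minimal separating transaction, unless the input is infeasible. -/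
noncomputable def RawInput.minimized (ics : List (InclusionDependency S)) (x : RawInput S) :
    List (Fact S) :=
  (x.candidate ics).foldl (dropIfPossible ics x.2.1 (x.world ics) x.2.2.1.flatten)
    (x.candidate ics)

/-- State of the parser: the constants of the current tuple, and the lists of transactions, both
read from right to left. -/
abbrev ParserState (S : Schema) : Type := List Const × List (List (List (Fact S)))

/-- One step of the parser. -/
def parseStep : Symbol S → ParserState S → ParserState S
  | .rel r, st => ([], ((factOfList r st.1 :: (st.2.headD []).headD []) :: (st.2.headD []).tail) ::
      st.2.tail)
  | .bit b, st => ((b :: st.1.headD []) :: st.1.tail, st.2)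
  | .endConst, st => ([] :: st.1, st.2)
  | .endTx, st => (st.1, ([] :: st.2.headD []) :: st.2.tail)
  | .endList, st => (st.1, [] :: st.2)

/-- The parser. -/
def parse (w : List (Symbol S)) : List (List (List (Fact S))) :=
  (w.foldr parseStep ([], [])).2

/-- The parsed input. -/
def readInput (w : List (Symbol S)) : RawInput S :=
  (((parse w).headD []).headD [], (((parse w).headD []).tail,
    (((parse w).tail.headD []), ((parse w).tail.tail.headD []))))

/-- The output word for an input word. -/
noncomputable def outputWord (ics : List (InclusionDependency S)) (w : List (Symbol S)) :
    List (Symbol S) :=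
  bif (readInput w).infeasible ics then [] else encodeTx ((readInput w).minimized ics)

/-! ### Running time of the ingredients of the algorithm. -/

section PolyTime

open StackProgram.PolyTime

variable {γ : Type*} [Enc (Symbol S) γ] (ics : List (InclusionDependency S))

theorem polyTime_rel {t : γ → Fact S} (ht : PolyTime (Symbol S) t) :
    PolyTime (Symbol S) fun x => (t x).1 :=
  fst.comp (β := Fin S.numRel × List Const)
    (ht.congr_enc (f := fun x => ((t x).1, List.ofFn (t x).2)) fun _ => rfl)

theorem polyTime_consts {t : γ → Fact S} (ht : PolyTime (Symbol S) t) :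
    PolyTime (Symbol S) fun x => List.ofFn (t x).2 :=
  snd.comp (β := Fin S.numRel × List Const)
    (ht.congr_enc (f := fun x => ((t x).1, List.ofFn (t x).2)) fun _ => rfl)

theorem polyTime_constAt {t : γ → Fact S} (ht : PolyTime (Symbol S) t) (i : ℕ) :
    PolyTime (Symbol S) fun x => constAt (t x) i :=
  (polyTime_consts ht).getD i []

theorem polyTime_mk (r : Fin S.numRel) {g : Fin (S.arity r) → γ → Const}
    (hg : ∀ j, PolyTime (Symbol S) (g j)) :
    PolyTime (Symbol S) fun x => (⟨r, fun j => g j x⟩ : Fact S) :=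
  ((const r).pair (ofFn hg)).congr_enc fun _ => rfl

theorem polyTime_factOfList (r : Fin S.numRel) {l : γ → List Const}
    (hl : PolyTime (Symbol S) l) : PolyTime (Symbol S) fun x => factOfList r (l x) :=
  polyTime_mk r fun j => hl.getD j []

theorem polyTime_supported {X : γ → List (Fact S)} {t : γ → Fact S}
    (hX : PolyTime (Symbol S) X) (ht : PolyTime (Symbol S) t) :
    PolyTime (Symbol S) fun x => supported ics (X x) (t x) := by
  refine all_const ics fun d => ((polyTime_rel ht).decide_eq (const d.src)).not.or
    (hX.any (p := fun x t' => decide (t'.1 = d.dst) &&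
      (List.finRange d.width).all fun l => decide (constAt (t x) (d.lhs l) = constAt t' (d.rhs l)))
      (((polyTime_rel snd).decide_eq (const d.dst)).and (all_const _ fun l => ?_)))
  exact (polyTime_constAt (ht.comp fst) _).decide_eq (polyTime_constAt snd _)

theorem polyTime_satisfies {X : γ → List (Fact S)} (hX : PolyTime (Symbol S) X) :
    PolyTime (Symbol S) fun x => satisfies ics (X x) :=
  hX.all (p := fun x t => supported ics (X x) t) (polyTime_supported ics (hX.comp fst) snd)

theorem polyTime_contains {W T : γ → List (Fact S)} (hW : PolyTime (Symbol S) W)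
    (hT : PolyTime (Symbol S) T) : PolyTime (Symbol S) fun x => contains (W x) (T x) :=
  hT.all (p := fun x t => decide (t ∈ W x)) (snd.decide_mem (hW.comp fst))

theorem polyTime_largestWorld {Ts : γ → List (List (Fact S))} {B : γ → List (Fact S)}
    (hTs : PolyTime (Symbol S) Ts) (hB : PolyTime (Symbol S) B) :
    PolyTime (Symbol S) fun x => largestWorld ics (Ts x) (B x) := by
  refine hB.append' (flatten ?_)
  refine filterIter (P := fun x A T => satisfies ics (B x ++ A.flatten ++ T))
    (polyTime_satisfies ics ?_) hTs (const []) fun _ => List.nil_sublist _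
  exact (((hB.comp (fst.comp fst))).append' (snd.comp fst).flatten).append' snd

theorem polyTime_largestPart {M X : γ → List (Fact S)} (hM : PolyTime (Symbol S) M)
    (hX : PolyTime (Symbol S) X) : PolyTime (Symbol S) fun x => largestPart ics (M x) (X x) := by
  refine filterIter (P := fun x Y t => supported ics (M x ++ Y) t)
    (polyTime_supported ics ?_ snd) hX hX fun _ => List.Sublist.refl _
  exact (hM.comp (fst.comp fst)).append' (snd.comp fst)

theorem polyTime_constants {T : γ → List (Fact S)} (hT : PolyTime (Symbol S) T) :
    PolyTime (Symbol S) fun x => constants (T x) :=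
  hT.flatMap (g := fun (_ : γ) (t : Fact S) => List.ofFn t.2)
    (polyTime_consts (t := fun y : γ × Fact S => y.2) snd)

theorem polyTime_freshConst {T : γ → List (Fact S)} (hT : PolyTime (Symbol S) T) :
    PolyTime (Symbol S) fun x => freshConst (T x) :=
  (polyTime_constants hT).flatten.append' (const [true])

/-- The length `n` is an arity and so fixed with the schema. The induction nests `n` calls of
`flatMap`, a number independent of the input; this is where the chase stays polynomial. -/
theorem polyTime_tuples {dom : γ → List Const} (hdom : PolyTime (Symbol S) dom) (n : ℕ) :
    PolyTime (Symbol S) fun x => tuples (dom x) n := by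
  induction n with
  | zero => exact const [[]]
  | succ n ih =>
    exact hdom.flatMap (g := fun x c => (tuples (dom x) n).map fun l => c :: l)
      ((ih.comp fst).map (g := fun y l => y.2 :: l) ((snd.comp fst).cons snd))

theorem polyTime_groundTuples {dom : γ → List Const} (hdom : PolyTime (Symbol S) dom) :
    PolyTime (Symbol S) fun x => (groundTuples (dom x) : List (Fact S)) :=
  flatMap_const _ fun r => (polyTime_tuples hdom (S.arity r)).map
    (g := fun _ l => factOfList r l) (polyTime_factOfList r snd)

theorem polyTime_demanded (d : InclusionDependency S) {c : γ → Const} {t : γ → Fact S}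
    (hc : PolyTime (Symbol S) c) (ht : PolyTime (Symbol S) t) :
    PolyTime (Symbol S) fun x => demanded d (c x) (t x) := by
  refine polyTime_mk d.dst fun j => ?_
  -- Whether `d` determines position `j` does not depend on the input, so this choice is made when
  -- the program is built.
  by_cases h : ∃ l, d.rhs l = j
  · simp only [h, dite_true]
    exact polyTime_constAt ht _
  · simp only [h, dite_false]
    exact hc

theorem polyTime_chase {c : γ → Const} {B : γ → List (Fact S)} (hc : PolyTime (Symbol S) c)
    (hB : PolyTime (Symbol S) B) : PolyTime (Symbol S) fun x => chase ics (c x) (B x) := by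
  refine filterIter (P := fun x X t => decide (t ∈ B x) || X.any fun s => ics.any fun d =>
      decide (s.1 = d.src) && decide (t = demanded d (c x) s)) ?_
    (polyTime_groundTuples (hc.cons (polyTime_constants hB))) (const []) fun _ =>
      List.nil_sublist _
  refine (snd.decide_mem (hB.comp (fst.comp fst))).or ((snd.comp fst).any
    (p := fun y s => ics.any fun d =>
      decide (s.1 = d.src) && decide (y.2 = demanded d (c y.1.1) s)) (any_const _ fun d => ?_))
  exact ((polyTime_rel snd).decide_eq (const d.src)).and ((snd.comp fst).decide_eq
    (polyTime_demanded d (hc.comp (fst.comp (fst.comp fst))) snd))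

theorem polyTime_dropIfPossible {Ts : γ → List (List (Fact S))} {M G X : γ → List (Fact S)}
    {t : γ → Fact S} (hTs : PolyTime (Symbol S) Ts) (hM : PolyTime (Symbol S) M)
    (hG : PolyTime (Symbol S) G) (hX : PolyTime (Symbol S) X) (ht : PolyTime (Symbol S) t) :
    PolyTime (Symbol S) fun x => dropIfPossible ics (Ts x) (M x) (G x) (X x) (t x) := by
  have h := polyTime_largestPart ics hM (hX.filter (p := fun x s => !decide (s = t x))
    (snd.decide_eq (ht.comp fst)).not)
  exact ite (polyTime_contains (polyTime_largestWorld ics hTs (hM.append' h)) hG) h hX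

theorem filterIter_subset {α : Type*} {P : List α → α → Bool} {L X : List α} (h : X.Sublist L) :
    (StackProgram.filterIter P L X).Sublist L := by
  unfold StackProgram.filterIter
  rcases List.eq_nil_or_concat L with rfl | ⟨l, a, hl⟩
  · simpa using h
  · conv_lhs => rw [hl]
    rw [List.concat_eq_append, List.foldl_append]
    exact List.filter_sublist.trans (by rw [hl, List.concat_eq_append])

theorem dropIfPossible_sublist (Ts : List (List (Fact S))) (M G X : List (Fact S)) (t : Fact S) :
    (dropIfPossible ics Ts M G X t).Sublist X := by
  unfold dropIfPossible
  cases contains _ _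
  · exact List.Sublist.refl _
  · exact (filterIter_subset (List.Sublist.refl _)).trans List.filter_sublist

theorem foldl_dropIfPossible_sublist (Ts : List (List (Fact S))) (M G : List (Fact S))
    (l : List (Fact S)) : ∀ X, (l.foldl (dropIfPossible ics Ts M G) X).Sublist X := by
  induction l with
  | nil => exact fun X => List.Sublist.refl _
  | cons t l ih => exact fun X => (ih _).trans (dropIfPossible_sublist ics Ts M G X t)

theorem polyTime_world : PolyTime (Symbol S) fun x : RawInput S => x.world ics :=
  polyTime_largestWorld ics (fst.comp snd) fst

theorem polyTime_candidate : PolyTime (Symbol S) fun x : RawInput S => x.candidate ics :=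
  polyTime_chase ics (polyTime_freshConst (fst.comp snd).flatten)
    (fst.comp (snd.comp snd)).flatten

theorem polyTime_infeasible : PolyTime (Symbol S) fun x : RawInput S => x.infeasible ics := by
  refine (snd.comp (snd.comp snd)).any (p := fun x : RawInput S => fun T =>
    contains (largestWorld ics x.2.1 (x.world ics ++ x.candidate ics)) T)
    (polyTime_contains ?_ snd)
  exact (polyTime_largestWorld ics (fst.comp snd)
    ((polyTime_world ics).append' (polyTime_candidate ics))).comp fst

/-- The accumulators only shrink: they are sublists of the candidate, whose size is already bounded.
-/
theorem polyTime_minimized : PolyTime (Symbol S) fun x : RawInput S => x.minimized ics := by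
  obtain ⟨B, hB⟩ := (polyTime_candidate ics).exists_length_le
  refine foldl (step := fun x : RawInput S => dropIfPossible ics x.2.1 (x.world ics)
    x.2.2.1.flatten) ?_ (polyTime_candidate ics) (polyTime_candidate ics) (bound := B) fun x l' _ =>
    (length_enc_le_of_sublist (foldl_dropIfPossible_sublist ics _ _ _ l' _)).trans (hB x)
  exact polyTime_dropIfPossible ics ((fst.comp snd).comp fst) ((polyTime_world ics).comp fst)
    ((fst.comp (snd.comp snd)).flatten.comp fst) (fst.comp snd) (snd.comp snd)

/-- Size of a parser state. -/
def ParserState.size (st : ParserState S) : ℕ :=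
  8 * (enc st.1 : List (Symbol S)).length + (enc st.2 : List (Symbol S)).length

theorem length_enc_headD_tail {α : Type*} [Enc (Symbol S) α] (l : List (List α)) :
    2 * (enc (l.headD []) : List (Symbol S)).length + (enc l.tail : List (Symbol S)).length ≤
      (enc l : List (Symbol S)).length := by
  cases l with
  | nil => simp [enc_nil]
  | cons a l => simp [enc_cons]

theorem length_enc_ofFn_getD_le (n : ℕ) : ∀ l : List Const,
    (enc (List.ofFn fun j : Fin n => l.getD j []) : List (Symbol S)).length ≤
      (enc l : List (Symbol S)).length + n := by
  induction n with
  | zero => simp [enc_nil]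
  | succ n ih =>
    intro l
    rw [List.ofFn_succ, enc_cons]
    cases l with
    | nil =>
      have := ih []
      simp [enc_nil] at this ⊢
      omega
    | cons c l =>
      have := ih l
      simp [enc_cons] at this ⊢
      omega

/-- A finished tuple moves from the constants into three nested lists, and each level doubles its
length by a block. The weight `8` in `ParserState.size` pays for this, so a step adds only a
constant and parsing grows the state linearly. -/
theorem exists_size_parseStep_le :
    ∃ K, ∀ (a : Symbol S) (st : ParserState S), (parseStep a st).size ≤ st.size + K := by
  refine ⟨100 + 8 * ∑ r, S.arity r, fun a st => ?_⟩
  obtain ⟨cs, Ls⟩ := st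
  have h₁ := length_enc_headD_tail (S := S) cs
  have h₂ := length_enc_headD_tail (S := S) Ls
  have h₃ := length_enc_headD_tail (S := S) (Ls.headD [])
  cases a with
  | rel r =>
    have h₄ := Finset.single_le_sum (f := S.arity) (fun _ _ => Nat.zero_le _) (Finset.mem_univ r)
    have h₅ : (enc (factOfList r cs) : List (Symbol S)).length ≤
        3 + ((enc cs : List (Symbol S)).length + S.arity r) := by
      show (block [Symbol.rel r] ++ (enc (List.ofFn fun j : Fin (S.arity r) => cs.getD j []) :
        List (Symbol S))).length ≤ _
      have := length_enc_ofFn_getD_le (S := S) (S.arity r) cs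
      simp only [List.length_append, length_block, List.length_cons, List.length_nil]
      omega
    simp only [ParserState.size, parseStep, enc_cons, enc_nil, List.length_append, length_block,
      List.length_nil]
    omega
  | bit b =>
    have h₄ : (enc b : List (Symbol S)).length ≤ 1 := by cases b <;> simp [enc_bool]
    simp only [ParserState.size, parseStep, enc_cons, List.length_append, length_block]
    omega
  | endConst | endTx | endList =>
    simp only [ParserState.size, parseStep, enc_cons, enc_nil, List.length_append, length_block,
      List.length_nil]
    omega

theorem polyTime_parseStep (a : Symbol S) {st : γ → ParserState S}
    (h : PolyTime (Symbol S) st) : PolyTime (Symbol S) fun x => parseStep a (st x) := by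
  have h₁ := fst.comp h
  have h₂ := snd.comp h
  cases a with
  | rel r =>
    exact (const []).pair ((((polyTime_factOfList r h₁).cons ((h₂.headD []).headD [])).cons
      (h₂.headD []).tail).cons h₂.tail)
  | bit b => exact (((const b).cons (h₁.headD [])).cons h₁.tail).pair h₂
  | endConst => exact ((const []).cons h₁).pair h₂
  | endTx => exact h₁.pair (((const []).cons (h₂.headD [])).cons h₂.tail)
  | endList => exact h₁.pair ((const []).cons h₂)

theorem polyTime_parse : PolyTime (Symbol S) (parse : List (Symbol S) → _) := by
  obtain ⟨K, hK⟩ := exists_size_parseStep_le (S := S)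
  have key : ∀ (l : List (Symbol S)) (st : ParserState S),
      (l.foldl (fun st a => parseStep a st) st).size ≤ st.size + l.length * K := by
    intro l
    induction l with
    | nil => simp
    | cons a l ih =>
      intro st
      have h₁ := ih (parseStep a st)
      have h₂ := hK a st
      simp only [List.foldl_cons, List.length_cons, add_mul, one_mul] at h₁ ⊢
      omega
  -- The parser folds from the right, that is, from the left over the reversed word.
  have := foldl (Γ := Symbol S) (γ := List (Symbol S)) (l := fun w => w.reverse)
    (b := fun _ => (([], []) : ParserState S)) (step := fun _ st a => parseStep a st)
    ((symbolCase (g := fun a (st : ParserState S) => parseStep a st)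
      fun a => polyTime_parseStep a .id).comp ((snd.comp snd).pair (fst.comp snd)))
    (const _) PolyTime.id.reverse (bound := Polynomial.X * Polynomial.C K + 1) fun w l' hl' => by
      have h₁ := key l' ([], [])
      have h₂ : l'.length ≤ (enc w : List (Symbol S)).length := by
        have := hl'.length_le
        rw [List.length_reverse] at this
        exact this.trans (length_le_length_enc w)
      have h₃ := Nat.mul_le_mul_right K h₂
      generalize l'.foldl (fun st a => parseStep a st) ([], []) = st at h₁
      obtain ⟨cs, Ls⟩ := st
      simp [ParserState.size, enc_nil] at h₁
      simp [enc_pair]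
      omega
  exact (snd.comp this).congr_enc fun w => by rw [List.foldl_reverse]; rfl

theorem polyTime_readInput : PolyTime (Symbol S) (readInput : List (Symbol S) → _) := by
  have h := polyTime_parse (S := S)
  exact ((h.headD []).headD []).pair ((h.headD []).tail.pair
    ((h.tail.headD []).pair (h.tail.tail.headD [])))

theorem polyTime_encodeTx {T : γ → List (Fact S)} (hT : PolyTime (Symbol S) T) :
    PolyTime (Symbol S) fun x => encodeTx (T x) := by
  refine (hT.flatMap (g := fun _ t => encodeFact t) ?_).append' (const [Symbol.endTx])
  have h₁ : PolyTime (Symbol S) fun y : γ × Fact S => (Symbol.rel y.2.1 : Symbol S) :=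
    (polyTime_rel (snd (α := γ))).congr_enc fun _ => rfl
  have h₂ : PolyTime (Symbol S) fun b : Bool => (Symbol.bit b : Symbol S) :=
    (ite .id (const (Symbol.bit true)) (const (Symbol.bit false))).congr_enc fun b => by
      cases b <;> rfl
  refine h₁.cons ((polyTime_consts snd).flatMap
    (g := fun _ c => c.map Symbol.bit ++ [Symbol.endConst]) ?_)
  exact (snd.map (g := fun _ b => Symbol.bit b) (h₂.comp snd)).append' (const _)

theorem polyTime_outputWord : PolyTime (Symbol S) (outputWord ics) :=
  ite ((polyTime_infeasible ics).comp polyTime_readInput) (const [])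
    (polyTime_encodeTx ((polyTime_minimized ics).comp polyTime_readInput))

end PolyTime

/-- The algorithm as a function of the input. -/
noncomputable def solve (ics : List (InclusionDependency S)) (x : Input S) :
    Option (List (Fact S)) :=
  let y : RawInput S := (x.state, (x.pending, (x.tin, x.tout)))
  bif y.infeasible ics then none else some (y.minimized ics)

/-! ### The parser inverts the encoding of inputs. -/

section Parser

theorem parse_const (c : Const) (st : ParserState S) :
    (c.map Symbol.bit ++ [Symbol.endConst]).foldr parseStep st = (c :: st.1, st.2) := by
  induction c with
  | nil => rfl
  | cons b c ih => rw [List.map_cons, List.cons_append, List.foldr_cons, ih]; rfl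

theorem parse_consts (l : List Const) (st : ParserState S) :
    (l.flatMap fun c => c.map Symbol.bit ++ [Symbol.endConst]).foldr parseStep st =
      (l ++ st.1, st.2) := by
  induction l with
  | nil => rfl
  | cons c l ih => rw [List.flatMap_cons, List.foldr_append, ih, parse_const]; rfl

/-- Reading from right to left, the parser meets the relation name after all constants of the tuple,
and can then assemble the tuple at once. -/
theorem parse_facts (F T : List (Fact S)) (Ts : List (List (Fact S)))
    (Ls : List (List (List (Fact S)))) :
    (F.flatMap encodeFact).foldr parseStep ([], (T :: Ts) :: Ls) =
      ([], ((F ++ T) :: Ts) :: Ls) := by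
  induction F with
  | nil => rfl
  | cons t F ih =>
    rw [List.flatMap_cons, List.foldr_append, ih, encodeFact, List.foldr_cons, parse_consts,
      parseStep]
    simp [factOfList_ofFn]

theorem parse_encodeTx (T : List (Fact S)) (Ts : List (List (Fact S)))
    (Ls : List (List (List (Fact S)))) :
    (encodeTx T).foldr parseStep ([], Ts :: Ls) = ([], (T :: Ts) :: Ls) := by
  rw [encodeTx, List.foldr_append]
  exact (parse_facts T [] Ts Ls).trans (by rw [List.append_nil])

theorem parse_encodeTxs (Ts : List (List (Fact S))) (Ls : List (List (List (Fact S)))) :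
    (encodeTxs Ts).foldr parseStep ([], Ls) = ([], Ts :: Ls) := by
  rw [encodeTxs, List.foldr_append]
  show (Ts.flatMap encodeTx).foldr parseStep ([], [] :: Ls) = _
  induction Ts with
  | nil => rfl
  | cons T Ts ih => rw [List.flatMap_cons, List.foldr_append, ih, parse_encodeTx]

theorem readInput_encodeInput (x : Input S) :
    readInput (encodeInput x) = (x.state, (x.pending, (x.tin, x.tout))) := by
  simp [readInput, parse, encodeInput, List.foldr_append, parse_encodeTxs, parse_encodeTx]

theorem outputWord_encodeInput (ics : List (InclusionDependency S)) (x : Input S) :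
    outputWord ics (encodeInput x) = encodeOutput (solve ics x) := by
  rw [outputWord, readInput_encodeInput, solve]
  cases RawInput.infeasible ics _ <;> rfl

end Parser

theorem solve_computable (ics : List (InclusionDependency S)) :
    Nonempty (Turing.TM2ComputableInPolyTime encodeInput encodeOutput (solve ics)) :=
  (polyTime_outputWord ics).tm2ComputableInPolyTime (outputWord_encodeInput ics)

end BlockchainDB

/-! ### Correctness of the algorithm -/

namespace StackProgram

/-! ### Fixed points of iterated filtering. -/

section FilterIter

variable {α : Type*} {P : List α → α → Bool} {L X : List α}

theorem filterIter_eq_iterate (P : List α → α → Bool) (L X : List α) :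
    filterIter P L X = (fun Y => L.filter (P Y))^[L.length] X := by
  rw [filterIter, List.foldl_const]

theorem filterIter_induction {Q : List α → Prop} (h₀ : Q X)
    (h : ∀ Y, Q Y → Q (L.filter (P Y))) : Q (filterIter P L X) := by
  rw [filterIter_eq_iterate]
  generalize L.length = n
  induction n with
  | zero => exact h₀
  | succ n ih => rw [Function.iterate_succ_apply']; exact h _ ih

/-- An increasing chain of sublists gains an element in each round until it stops, and once
stationary it remains so. As all members are sublists of `L`, `L.length` rounds suffice. -/
theorem iterate_fixed_of_increasing {F : List α → List α}
    (h : ∀ n, (F^[n] X).Sublist (F^[n + 1] X)) (hL : ∀ n, (F^[n] X).Sublist L) :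
    F (F^[L.length] X) = F^[L.length] X := by
  have key : ∀ n, F^[n] X = F^[n + 1] X ∨ n ≤ (F^[n] X).length := by
    intro n
    induction n with
    | zero => exact Or.inr (Nat.zero_le _)
    | succ n ih =>
      rcases ih with ih | ih
      · left
        rw [Function.iterate_succ_apply', Function.iterate_succ_apply' F (n + 1), ← ih]
      · by_cases he : F^[n] X = F^[n + 1] X
        · left
          rw [Function.iterate_succ_apply', Function.iterate_succ_apply' F (n + 1), ← he]
        · right
          by_contra hlt
          exact he ((h n).eq_of_length_le (by omega))
  rw [← Function.iterate_succ_apply' F]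
  rcases key L.length with h' | h'
  · exact h'.symm
  · refine ((h _).eq_of_length_le ?_).symm
    exact (hL _).length_le.trans h'

theorem iterate_fixed_of_decreasing {F : List α → List α}
    (h : ∀ n, (F^[n + 1] X).Sublist (F^[n] X)) : F (F^[X.length] X) = F^[X.length] X := by
  have key : ∀ n, F^[n] X = F^[n + 1] X ∨ (F^[n] X).length + n ≤ X.length := by
    intro n
    induction n with
    | zero => exact Or.inr le_rfl
    | succ n ih =>
      rcases ih with ih | ih
      · left
        rw [Function.iterate_succ_apply', Function.iterate_succ_apply' F (n + 1), ← ih]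
      · by_cases he : F^[n] X = F^[n + 1] X
        · left
          rw [Function.iterate_succ_apply', Function.iterate_succ_apply' F (n + 1), ← he]
        · right
          by_contra hlt
          exact he ((h n).eq_of_length_le (by omega)).symm
  rw [← Function.iterate_succ_apply' F]
  rcases key X.length with h' | h'
  · exact h'.symm
  · exact (h _).eq_of_length_le (by omega)

theorem filter_sublist_filter {p q : α → Bool} (h : ∀ a ∈ L, p a = true → q a = true) :
    (L.filter p).Sublist (L.filter q) := by
  have : L.filter p = (L.filter q).filter p := by
    rw [List.filter_filter]
    exact List.filter_congr fun a ha => by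
      cases hp : p a
      · rfl
      · simp [h a ha hp]
  rw [this]
  exact List.filter_sublist

/-- Iterated filtering from the empty list reaches a fixed point if the condition is monotone on a
family `Good` of lists. -/
theorem filterIter_nil_spec (Good : List α → Prop) (h₀ : Good [])
    (hstep : ∀ Y, Good Y → Good (L.filter (P Y)))
    (hmono : ∀ X Y, Good X → Good Y → X ⊆ Y → ∀ a ∈ L, P X a = true → P Y a = true) :
    Good (filterIter P L []) ∧
      ∀ a, a ∈ filterIter P L [] ↔ a ∈ L ∧ P (filterIter P L []) a = true := by
  refine ⟨filterIter_induction h₀ hstep, ?_⟩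
  have good : ∀ n, Good ((fun Y => L.filter (P Y))^[n] []) := by
    intro n
    induction n with
    | zero => exact h₀
    | succ n ih => rw [Function.iterate_succ_apply']; exact hstep _ ih
  have inc : ∀ n, ((fun Y => L.filter (P Y))^[n] []).Sublist
      ((fun Y => L.filter (P Y))^[n + 1] []) := by
    intro n
    induction n with
    | zero => exact List.nil_sublist _
    | succ n ih =>
      rw [Function.iterate_succ_apply', Function.iterate_succ_apply' _ (n + 1)]
      exact filter_sublist_filter (hmono _ _ (good n) (good (n + 1)) ih.subset)
  have le : ∀ n, ((fun Y => L.filter (P Y))^[n] []).Sublist L := by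
    intro n
    cases n with
    | zero => exact List.nil_sublist _
    | succ n => rw [Function.iterate_succ_apply']; exact List.filter_sublist
  have fixed := iterate_fixed_of_increasing inc le
  rw [← filterIter_eq_iterate] at fixed
  intro a
  conv_lhs => rw [← fixed]
  exact List.mem_filter

/-- Iterated filtering from the whole list reaches a fixed point if the condition is monotone. -/
theorem filterIter_self_spec
    (hmono : ∀ X Y, X ⊆ Y → ∀ a ∈ L, P X a = true → P Y a = true) (a : α) :
    a ∈ filterIter P L L ↔ a ∈ L ∧ P (filterIter P L L) a = true := by
  have dec : ∀ n, ((fun Y => L.filter (P Y))^[n + 1] L).Sublist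
      ((fun Y => L.filter (P Y))^[n] L) := by
    intro n
    induction n with
    | zero => exact List.filter_sublist
    | succ n ih =>
      have h := filter_sublist_filter (hmono _ _ ih.subset)
      rw [Function.iterate_succ_apply' _ (n + 1)]
      convert h using 1
      exact Function.iterate_succ_apply' _ n L
  have fixed := iterate_fixed_of_decreasing dec
  rw [← filterIter_eq_iterate] at fixed
  conv_lhs => rw [← fixed]
  exact List.mem_filter

end FilterIter

end StackProgram

/-! ### Largest worlds and the characterization of separating transactions. -/

namespace BlockchainDB

open StackProgram Relation

variable {S : Schema} {ic : Set (InclusionDependency S)} {ics : List (InclusionDependency S)}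

/-- The state `I` holds the tuples that the dependencies `ic` demand for `t`. -/
def Supported (ic : Set (InclusionDependency S)) (I : Instance S) (t : Fact S) : Prop :=
  ∀ d ∈ ic, ∀ a : Fin (S.arity d.src) → Const, t = ⟨d.src, a⟩ →
    ∃ b : Fin (S.arity d.dst) → Const, (⟨d.dst, b⟩ : Fact S) ∈ I ∧ ∀ l, a (d.lhs l) = b (d.rhs l)

theorem toFinset_subset_toFinset {X Y : List (Fact S)} (h : X ⊆ Y) : X.toFinset ⊆ Y.toFinset :=
  fun _ ht => List.mem_toFinset.2 (h (List.mem_toFinset.1 ht))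

theorem Supported.mono {I J : Instance S} {t : Fact S} (h : Supported ic I t) (hIJ : I ⊆ J) :
    Supported ic J t := fun d hd a ha =>
  let ⟨b, hb, hl⟩ := h d hd a ha
  ⟨b, hIJ hb, hl⟩

theorem satisfies_iff_supported {I : Instance S} :
    Satisfies I ic ↔ ∀ t ∈ I, Supported ic I t :=
  ⟨fun h _ ht d hd a ha => h d hd a (ha ▸ ht), fun h d hd a ha => h _ ha d hd a rfl⟩

/-- A dependency constrains single tuples by asking for witnesses: each tuple of the union finds its
witness in the part it comes from. -/
theorem Satisfies.union {I J : Instance S} (hI : Satisfies I ic) (hJ : Satisfies J ic) :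
    Satisfies (I ∪ J) ic := by
  rw [satisfies_iff_supported] at *
  intro t ht
  rcases Finset.mem_union.1 ht with h | h
  · exact (hI t h).mono Finset.subset_union_left
  · exact (hJ t h).mono Finset.subset_union_right

theorem supported_eq_true (hics : ∀ d, d ∈ ics ↔ d ∈ ic) (X : List (Fact S)) (t : Fact S) :
    supported ics X t = true ↔ Supported ic X.toFinset t := by
  simp only [supported, List.all_eq_true, Bool.or_eq_true, Bool.not_eq_true',
    decide_eq_false_iff_not, List.any_eq_true, Bool.and_eq_true, decide_eq_true_eq,
    List.mem_finRange, forall_true_left]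
  constructor
  · rintro h d hd a rfl
    rcases h d ((hics d).2 hd) with h | ⟨⟨r, b⟩, hb, rfl, hl⟩
    · exact absurd rfl h
    · exact ⟨b, by simpa using hb, fun l => by
        have := hl l
        rwa [constAt_mk, constAt_mk] at this⟩
  · intro h d hd
    by_cases ht : t.1 = d.src
    · right
      obtain ⟨r, a⟩ := t
      obtain rfl : r = d.src := ht
      obtain ⟨b, hb, hl⟩ := h d ((hics d).1 hd) a rfl
      exact ⟨⟨d.dst, b⟩, by simpa using hb, rfl, fun l => by
        rw [constAt_mk, constAt_mk]; exact hl l⟩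
    · exact Or.inl ht

theorem satisfies_eq_true (hics : ∀ d, d ∈ ics ↔ d ∈ ic) (X : List (Fact S)) :
    satisfies ics X = true ↔ Satisfies X.toFinset ic := by
  rw [satisfies, List.all_eq_true, satisfies_iff_supported]
  simp only [supported_eq_true hics, List.mem_toFinset]

theorem contains_eq_true (W T : List (Fact S)) :
    contains W T = true ↔ T.toFinset ⊆ W.toFinset := by
  simp [contains, Finset.subset_iff]

/-- `W` is the largest state reachable from `B` by appending transactions in `P`. -/
structure IsLargestWorld (ic : Set (InclusionDependency S)) (P : Finset (Instance S))
    (B W : Instance S) : Prop where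
  base : B ⊆ W
  sat : Satisfies W ic
  closed : ∀ T ∈ P, Satisfies (W ∪ T) ic → T ⊆ W
  induction : ∀ Q : Fact S → Prop, (∀ t ∈ B, Q t) → (∀ V : Instance S, (∀ t ∈ V, Q t) →
    ∀ T ∈ P, Satisfies (V ∪ T) ic → ∀ t ∈ T, Q t) → ∀ t ∈ W, Q t
  reach : ∀ D : Database S, D.ic = ic → P ⊆ D.pending → ReflTransGen D.CanAppend B W

/-- Transactions that can each be appended to `V` can be appended one after another, since the
consistent unions combine. -/
theorem reflTransGen_union_flatten {D : Database S} {V : Instance S} (hV : Satisfies V D.ic)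
    (A : List (List (Fact S))) (hA : ∀ T ∈ A, T.toFinset ∈ D.pending ∧
      Satisfies (V ∪ T.toFinset) D.ic) :
    ReflTransGen D.CanAppend V (V ∪ A.flatten.toFinset) ∧
      Satisfies (V ∪ A.flatten.toFinset) D.ic := by
  induction A with
  | nil => simpa using ⟨ReflTransGen.refl, hV⟩
  | cons T A ih =>
    obtain ⟨h₁, h₂⟩ := ih fun T' hT' => hA T' (by simp [hT'])
    obtain ⟨h₃, h₄⟩ := hA T (by simp)
    have e : V ∪ (T :: A).flatten.toFinset = V ∪ A.flatten.toFinset ∪ T.toFinset := by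
      rw [List.flatten_cons, List.toFinset_append, Finset.union_comm T.toFinset,
        Finset.union_assoc]
    have e' : V ∪ A.flatten.toFinset ∪ T.toFinset =
        (V ∪ A.flatten.toFinset) ∪ (V ∪ T.toFinset) := by
      ext t
      simp only [Finset.mem_union]
      tauto
    have h₅ : Satisfies (V ∪ A.flatten.toFinset ∪ T.toFinset) D.ic := e' ▸ h₂.union h₄
    rw [e]
    exact ⟨h₁.tail (Or.inr ⟨_, h₃, rfl, h₅⟩), h₅⟩

/-- Each round appends all transactions that fit the current state, and those already in still fit;
at the fixed point nothing more fits. The field `reach` ranges over all databases with at least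
these pending transactions, so that it also applies after a transaction has been issued. -/
theorem isLargestWorld_largestWorld (hics : ∀ d, d ∈ ics ↔ d ∈ ic) (Ts : List (List (Fact S)))
    {B : List (Fact S)} (hB : Satisfies B.toFinset ic) :
    IsLargestWorld ic (toTransactions Ts) B.toFinset (largestWorld ics Ts B).toFinset := by
  have mem_P : ∀ T : List (Fact S), T ∈ Ts → T.toFinset ∈ toTransactions Ts := fun T hT => by
    simp only [toTransactions, List.mem_toFinset, List.mem_map]
    exact ⟨T, hT, rfl⟩
  let P : List (List (Fact S)) → List (Fact S) → Bool :=
    fun A T => satisfies ics (B ++ A.flatten ++ T)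
  have hP : ∀ A T, P A T = true ↔
      Satisfies (B.toFinset ∪ A.flatten.toFinset ∪ T.toFinset) ic := fun A T => by
    rw [satisfies_eq_true hics, List.toFinset_append, List.toFinset_append]
  -- The test `P` is monotone only towards selections that are themselves consistent with the base;
  -- all iterates are of this kind.
  let Good : List (List (Fact S)) → Prop :=
    fun A => A ⊆ Ts ∧ Satisfies (B.toFinset ∪ A.flatten.toFinset) ic
  have sub : ∀ {A : List (List (Fact S))} {T}, T ∈ A → T.toFinset ⊆ A.flatten.toFinset :=
    fun {A T} hT t ht => by
      rw [List.mem_toFinset] at *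
      exact List.mem_flatten_of_mem hT ht
  have good_sub : ∀ A, Good A → A ⊆ Ts.filter (P A) := fun A hA T hT => by
    rw [List.mem_filter, hP, Finset.union_eq_left.2 ((sub hT).trans Finset.subset_union_right)]
    exact ⟨hA.1 hT, hA.2⟩
  have flatten_union : ∀ {A A' : List (List (Fact S))}, A ⊆ A' →
      A.flatten.toFinset ⊆ A'.flatten.toFinset := fun {A A'} h t ht => by
    simp only [List.mem_toFinset, List.mem_flatten] at *
    obtain ⟨T, hT, ht⟩ := ht
    exact ⟨T, h hT, ht⟩
  have step_eq : ∀ A, Good A → B.toFinset ∪ (Ts.filter (P A)).flatten.toFinset =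
      B.toFinset ∪ A.flatten.toFinset ∪ (Ts.filter (P A)).flatten.toFinset := fun A hA => by
    rw [Finset.union_assoc, Finset.union_eq_right.2 (flatten_union (good_sub A hA))]
  have step : ∀ D : Database S, D.ic = ic → toTransactions Ts ⊆ D.pending → ∀ A, Good A →
      ReflTransGen D.CanAppend (B.toFinset ∪ A.flatten.toFinset)
        (B.toFinset ∪ (Ts.filter (P A)).flatten.toFinset) ∧
      Satisfies (B.toFinset ∪ (Ts.filter (P A)).flatten.toFinset) ic := by
    rintro D rfl hD A hA
    rw [step_eq A hA]
    exact reflTransGen_union_flatten hA.2 _ fun T hT =>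
      ⟨hD (mem_P T (List.mem_filter.1 hT).1), (hP _ _).1 (List.mem_filter.1 hT).2⟩
  -- Only the consistency half of `step` is wanted, so any database serves; the empty state
  -- satisfies every dependency.
  have good_step : ∀ A, Good A → Good (Ts.filter (P A)) := fun A hA =>
    ⟨List.filter_sublist.subset, (step ⟨∅, ic, toTransactions Ts,
      satisfies_iff_supported.2 (by simp)⟩ rfl (Finset.Subset.refl _) A hA).2⟩
  have good_nil : Good [] := ⟨List.nil_subset _, by simpa using hB⟩
  have good_mono : ∀ X Y, Good X → Good Y → X ⊆ Y → ∀ T ∈ Ts, P X T = true → P Y T = true := by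
    intro X Y _ hY hXY T _ hT
    rw [hP] at hT ⊢
    have e : B.toFinset ∪ Y.flatten.toFinset ∪ T.toFinset = (B.toFinset ∪ Y.flatten.toFinset) ∪
        (B.toFinset ∪ X.flatten.toFinset ∪ T.toFinset) := by
      have := flatten_union hXY
      ext t
      have := @this t
      simp only [Finset.mem_union]
      tauto
    rw [e]
    exact hY.2.union hT
  obtain ⟨good, fixed⟩ := filterIter_nil_spec Good good_nil good_step good_mono
  have eW : (largestWorld ics Ts B).toFinset =
      B.toFinset ∪ (filterIter P Ts []).flatten.toFinset := by
    rw [largestWorld, List.toFinset_append]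
    rfl
  rw [eW]
  refine ⟨Finset.subset_union_left, good.2, fun T hT hs => ?_, fun Q h₀ h => ?_, fun D hD hD' => ?_⟩
  · simp only [toTransactions, List.mem_toFinset, List.mem_map] at hT
    obtain ⟨T, hT, rfl⟩ := hT
    exact (sub ((fixed T).2 ⟨hT, (hP _ _).2 hs⟩)).trans Finset.subset_union_right
  · refine filterIter_induction (Q := fun A => ∀ t ∈ B.toFinset ∪ A.flatten.toFinset, Q t)
      (by simpa using h₀) fun A hA t ht => ?_
    rcases Finset.mem_union.1 ht with ht | ht
    · exact h₀ t ht
    · simp only [List.mem_toFinset, List.mem_flatten, List.mem_filter] at ht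
      obtain ⟨T, ⟨hT, hs⟩, ht⟩ := ht
      exact h _ hA _ (mem_P T hT) ((hP _ _).1 hs) t (by simpa using ht)
  · refine (filterIter_induction (Q := fun A => Good A ∧
      ReflTransGen D.CanAppend B.toFinset (B.toFinset ∪ A.flatten.toFinset))
      ⟨good_nil, by simpa using ReflTransGen.refl⟩ fun A hA => ?_).2
    exact ⟨good_step A hA.1, hA.2.trans (step D hD hD' A hA.1).1⟩

/-- If `U ⊆ V` and `U ∪ T` is consistent, then so is `V ∪ T`, and closedness puts `T` into `V`. So
no append on the way to `W` leaves `V`. -/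
theorem IsLargestWorld.subset_of_closed {P : Finset (Instance S)} {B W V : Instance S}
    (hW : IsLargestWorld ic P B W) (hB : B ⊆ V) (hV : Satisfies V ic)
    (hc : ∀ T ∈ P, Satisfies (V ∪ T) ic → T ⊆ V) : W ⊆ V :=
  hW.induction (· ∈ V) hB fun U hU T hT hs => by
    refine hc T hT ?_
    have : V ∪ T = V ∪ (U ∪ T) := by
      rw [← Finset.union_assoc, Finset.union_eq_left.2 hU]
    rw [this]
    exact hV.union hs

theorem IsLargestWorld.mono {P : Finset (Instance S)} {B W B' W' : Instance S}
    (hW : IsLargestWorld ic P B W) (hW' : IsLargestWorld ic P B' W') (h : B ⊆ B') : W ⊆ W' :=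
  hW.subset_of_closed (h.trans hW'.base) hW'.sat hW'.closed

/-- Characterization of separating transactions by largest worlds. -/
theorem isSeparating_iff {D : Database S} {Tin Tout : Finset (Instance S)} {M T V : Instance S}
    (hM : IsLargestWorld D.ic D.pending D.state M)
    (hV : Satisfies (M ∪ T) D.ic → IsLargestWorld D.ic D.pending (M ∪ T) V) :
    D.IsSeparating Tin Tout T ↔ Satisfies (M ∪ T) D.ic ∧ Tin.biUnion id ⊆ V ∧
      ∀ T' ∈ Tout, ¬ T' ⊆ V := by
  -- Climb to `M`, append `T`, then climb to `V`.
  have reach : Satisfies (M ∪ T) D.ic → (D.issue T).IsPossibleWorld V := fun hs => by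
    have h₁ := hM.reach (D.issue T) rfl (Finset.subset_insert _ _)
    have h₂ := (hV hs).reach (D.issue T) rfl (Finset.subset_insert _ _)
    have h₃ : (D.issue T).CanAppend M (M ∪ T) := Or.inr ⟨T, Finset.mem_insert_self _ _, rfl, hs⟩
    exact TransGen.trans_left (TransGen.tail' h₁ h₃) h₂
  -- Every append stays inside `V`: `T` lies in it, and pending transactions are absorbed by
  -- closedness.
  have below : Satisfies (M ∪ T) D.ic → ∀ W, (D.issue T).IsPossibleWorld W → W ⊆ V := by
    intro hs W hW
    have hW' : ReflTransGen (D.issue T).CanAppend D.state W := hW.to_reflTransGen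
    induction hW' with
    | refl => exact (hM.base.trans Finset.subset_union_left).trans (hV hs).base
    | @tail W W' h₁ h₂ ih =>
      have ih : W ⊆ V := by
        rcases reflTransGen_iff_eq_or_transGen.1 h₁ with rfl | h
        · exact (hM.base.trans Finset.subset_union_left).trans (hV hs).base
        · exact ih h
      rcases h₂ with rfl | ⟨T', hT', rfl, hs'⟩
      · exact ih
      · refine Finset.union_subset ih ?_
        rcases Finset.mem_insert.1 hT' with rfl | hT'
        · exact Finset.subset_union_right.trans (hV hs).base
        · refine (hV hs).closed T' hT' ?_
          have : V ∪ T' = V ∪ (W ∪ T') := by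
            rw [← Finset.union_assoc, Finset.union_eq_left.2 ih]
          rw [this]
          exact (hV hs).sat.union hs'
  constructor
  · rintro ⟨⟨W, hW, hsub⟩, hout⟩
    have hs : Satisfies (M ∪ T) D.ic := by
      -- As long as only pending transactions are used, the states stay below `M`. An append of `T`
      -- to a state below `M` shows that `M ∪ T` is consistent.
      have key : W ⊆ M ∨ Satisfies (M ∪ T) D.ic := by
        have hW' : ReflTransGen (D.issue T).CanAppend D.state W := hW.to_reflTransGen
        clear hW hsub
        induction hW' with
        | refl => exact Or.inl hM.base
        | @tail W W' h₁ h₂ ih =>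
          rcases ih with ih | ih
          · rcases h₂ with rfl | ⟨T', hT', rfl, hs'⟩
            · exact Or.inl ih
            · have e : M ∪ T' = M ∪ (W ∪ T') := by
                rw [← Finset.union_assoc, Finset.union_eq_left.2 ih]
              have hs'' : Satisfies (M ∪ T') D.ic := e ▸ hM.sat.union hs'
              rcases Finset.mem_insert.1 hT' with rfl | hT'
              · exact Or.inr hs''
              · exact Or.inl (Finset.union_subset ih (hM.closed T' hT' hs''))
          · exact Or.inr ih
      rcases key with h | h
      -- Here `T ⊆ W ⊆ M`, so `M ∪ T` is `M` itself.
      · rw [Finset.union_eq_left.2 ((Finset.subset_union_left.trans hsub).trans h)]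
        exact hM.sat
      · exact h
    exact ⟨hs, (Finset.subset_union_right.trans hsub).trans (below hs W hW),
      hout V (reach hs) (Finset.subset_union_right.trans (hV hs).base)⟩
  · rintro ⟨hs, hin, hout⟩
    exact ⟨⟨V, reach hs, Finset.union_subset (Finset.subset_union_right.trans (hV hs).base) hin⟩,
      fun W hW _ T' hT' h => hout T' hT' (h.trans (below hs W hW))⟩

/-! ### The chase with one fresh constant and its universality. -/

section Chase

theorem mem_tuples {dom : List Const} {n : ℕ} : ∀ {l : List Const},
    l ∈ tuples dom n ↔ l.length = n ∧ ∀ c ∈ l, c ∈ dom := by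
  induction n with
  | zero =>
    intro l
    simp only [tuples, List.mem_singleton, List.length_eq_zero_iff]
    exact ⟨fun h => ⟨h, by simp [h]⟩, fun h => h.1⟩
  | succ n ih =>
    intro l
    simp only [tuples, List.mem_flatMap, List.mem_map, ih]
    constructor
    · rintro ⟨c, hc, l, ⟨hl, hl'⟩, rfl⟩
      simp [hl, hc]
      exact hl'
    · rintro ⟨hl, hl'⟩
      cases l with
      | nil => simp at hl
      | cons c l => exact ⟨c, hl' c (by simp), l, ⟨by simpa using hl, fun c hc =>
          hl' c (by simp [hc])⟩, rfl⟩

theorem mem_groundTuples {dom : List Const} {t : Fact S} :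
    t ∈ groundTuples dom ↔ ∀ i, t.2 i ∈ dom := by
  simp only [groundTuples, List.mem_flatMap, List.mem_finRange, true_and, List.mem_map, mem_tuples]
  constructor
  · rintro ⟨r, l, ⟨hl, hl'⟩, rfl⟩ i
    have : i < l.length := by rw [hl]; exact i.2
    simp only [factOfList, List.getD_eq_getElem _ _ this]
    exact hl' _ (List.getElem_mem _)
  · intro h
    exact ⟨t.1, List.ofFn t.2, ⟨by simp, by simpa using h⟩, factOfList_ofFn t⟩

theorem mem_constants {T : List (Fact S)} {c : Const} :
    c ∈ constants T ↔ ∃ t ∈ T, ∃ i, t.2 i = c := by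
  simp [constants]

theorem ne_freshConst {T : List (Fact S)} {t : Fact S} (ht : t ∈ T) (i : Fin (S.arity t.1)) :
    t.2 i ≠ freshConst T := by
  have h : t.2 i ∈ constants T := mem_constants.2 ⟨t, ht, i, rfl⟩
  have h' : (t.2 i).length ≤ (constants T).flatten.length :=
    (List.sublist_flatten_of_mem h).length_le
  intro e
  have := congrArg List.length e
  simp only [freshConst, List.length_append, List.length_singleton] at this
  omega

/-- Since the attributes on the right are distinct, the position determines the index, and the
chosen index is `l`. -/
theorem demanded_rhs (d : InclusionDependency S) (c : Const) (a : Fin (S.arity d.src) → Const)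
    (l : Fin d.width) : (demanded d c ⟨d.src, a⟩).2 (d.rhs l) = a (d.lhs l) := by
  have h : ∃ l', d.rhs l' = d.rhs l := ⟨l, rfl⟩
  simp only [demanded, h, dite_true]
  rw [d.rhs_injective h.choose_spec, constAt_mk]

theorem demanded_apply (d : InclusionDependency S) (c : Const) (a : Fin (S.arity d.src) → Const)
    (j : Fin (S.arity d.dst)) : (demanded d c ⟨d.src, a⟩).2 j = c ∨
      ∃ l, d.rhs l = j := by
  by_cases h : ∃ l, d.rhs l = j
  · exact Or.inr h
  · left
    simp only [demanded, h, dite_false]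

variable {c : Const} {B : List (Fact S)}

theorem mem_chase {t : Fact S} : t ∈ chase ics c B ↔ t ∈ groundTuples (c :: constants B) ∧
    (t ∈ B ∨ ∃ s ∈ chase ics c B, ∃ d ∈ ics, s.1 = d.src ∧ t = demanded d c s) := by
  refine ((filterIter_nil_spec (fun _ => True) trivial (fun _ _ => trivial) ?_).2 t).trans ?_
  · intro X Y _ _ h t _ ht
    simp only [Bool.or_eq_true, decide_eq_true_eq, List.any_eq_true, Bool.and_eq_true] at ht ⊢
    rcases ht with ht | ⟨s, hs, ht⟩
    · exact Or.inl ht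
    · exact Or.inr ⟨s, h hs, ht⟩
  · simp only [Bool.or_eq_true, decide_eq_true_eq, List.any_eq_true, Bool.and_eq_true]
    rfl

theorem subset_chase {t : Fact S} (ht : t ∈ B) : t ∈ chase ics c B :=
  mem_chase.2 ⟨mem_groundTuples.2 fun i => List.mem_cons_of_mem _ (mem_constants.2 ⟨t, ht, i, rfl⟩),
    Or.inl ht⟩

/-- A demanded tuple uses only constants of its source and `c`, so it never leaves the finite set of
ground tuples being filtered. -/
theorem satisfies_chase (hics : ∀ d, d ∈ ics ↔ d ∈ ic) :
    Satisfies (chase ics c B).toFinset ic := by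
  intro d hd a ha
  rw [List.mem_toFinset] at ha
  refine ⟨(demanded d c ⟨d.src, a⟩).2, ?_, fun l => (demanded_rhs d c a l).symm⟩
  rw [List.mem_toFinset]
  refine mem_chase.2 ⟨mem_groundTuples.2 fun j => ?_, Or.inr ⟨_, ha, d, (hics d).2 hd, rfl, rfl⟩⟩
  rcases demanded_apply d c a j with h | ⟨l, rfl⟩
  · exact List.mem_cons.2 (Or.inl h)
  · have := mem_groundTuples.1 (mem_chase.1 ha).1 (d.lhs l)
    exact (demanded_rhs d c a l).symm ▸ this

/-- Some tuple of `V` agrees with `t` at all positions where `t` does not hold `c`. -/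
def Dominated (c : Const) (V : Instance S) (t : Fact S) : Prop :=
  ∃ b : Fin (S.arity t.1) → Const, (⟨t.1, b⟩ : Fact S) ∈ V ∧ ∀ i, t.2 i ≠ c → b i = t.2 i

theorem Dominated.of_mem {V : Instance S} {t : Fact S} (h : t ∈ V) : Dominated c V t :=
  ⟨t.2, h, fun _ _ => rfl⟩

theorem Dominated.mem {V : Instance S} {t : Fact S} (h : Dominated c V t) (hc : ∀ i, t.2 i ≠ c) :
    t ∈ V := by
  obtain ⟨b, hb, h⟩ := h
  obtain rfl : b = t.2 := funext fun i => h i (hc i)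
  exact hb

/-- Each chase step is imitated in `V`. A demanded tuple holds `c` at the undetermined positions,
where nothing is required; elsewhere a constant other than `c` was copied from the source, and the
witness in `V` copies it from the dominating tuple. -/
theorem dominated_chase (hics : ∀ d, d ∈ ics ↔ d ∈ ic) {V : Instance S} (hV : Satisfies V ic)
    (hB : B.toFinset ⊆ V) : ∀ t ∈ chase ics c B, Dominated c V t := by
  refine filterIter_induction (Q := fun X => ∀ t ∈ X, Dominated c V t) (by simp) fun X hX t ht => ?_
  simp only [List.mem_filter, Bool.or_eq_true, decide_eq_true_eq, List.any_eq_true,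
    Bool.and_eq_true] at ht
  rcases ht.2 with h | ⟨⟨r, a⟩, hs, d, hd, hr, rfl⟩
  · exact .of_mem (hB (List.mem_toFinset.2 h))
  · obtain rfl : r = d.src := hr
    obtain ⟨a', ha', haa'⟩ := hX _ hs
    obtain ⟨b, hb, hl⟩ := hV d ((hics d).1 hd) a' ha'
    refine ⟨b, hb, fun j hj => ?_⟩
    rcases demanded_apply d c a j with h | ⟨l, rfl⟩
    · exact absurd h hj
    · rw [demanded_rhs] at hj
      exact (hl l).symm.trans ((haa' (d.lhs l) hj).trans (demanded_rhs d c a l).symm)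

/-- The largest world of a chase is dominated by any world with the required tuples. -/
theorem dominated_largestWorld {P : Finset (Instance S)} {M T W V : Instance S}
    (hW : IsLargestWorld ic P (M ∪ T) W) (hMV : M ⊆ V) (hT : ∀ t ∈ T, Dominated c V t)
    (hV : Satisfies V ic) (hclosed : ∀ T ∈ P, Satisfies (V ∪ T) ic → T ⊆ V)
    (hfresh : ∀ T ∈ P, ∀ t ∈ T, ∀ i, t.2 i ≠ c) : ∀ t ∈ W, Dominated c V t := by
  refine hW.induction _ (fun t ht => ?_) fun U hU T' hT' hs t ht => .of_mem ?_
  · rcases Finset.mem_union.1 ht with h | h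
    · exact .of_mem (hMV h)
    · exact hT t h
  · refine hclosed T' hT' (satisfies_iff_supported.2 fun s hs' => ?_) ht
    rcases Finset.mem_union.1 hs' with h | h
    · exact (satisfies_iff_supported.1 hV s h).mono Finset.subset_union_left
    · rintro d hd a rfl
      obtain ⟨b, hb, hl⟩ := hs d hd a (Finset.mem_union_right _ h)
      rcases Finset.mem_union.1 hb with hb | hb
      -- The witness `b` may contain `c`, but at the compared positions it repeats constants of
      -- `T'`, which are not `c`. So the tuple of `V` dominating `b` is a witness too.
      · obtain ⟨b', hb', hbb'⟩ := hU _ hb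
        refine ⟨b', Finset.mem_union_left _ hb', fun l => ?_⟩
        rw [hl l]
        refine (hbb' (d.rhs l) ?_).symm
        show b (d.rhs l) ≠ c
        rw [← hl l]
        exact hfresh T' hT' _ h (d.lhs l)
      · exact ⟨b, Finset.mem_union_right _ hb, hl⟩

end Chase

/-! ### Greedy minimization. -/

section Minimization

theorem mem_largestPart (hics : ∀ d, d ∈ ics ↔ d ∈ ic) (M X : List (Fact S)) (t : Fact S) :
    t ∈ largestPart ics M X ↔
      t ∈ X ∧ Supported ic (M.toFinset ∪ (largestPart ics M X).toFinset) t := by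
  refine (filterIter_self_spec ?_ t).trans ?_
  · intro Y Z h t _ ht
    rw [supported_eq_true hics, List.toFinset_append] at *
    exact ht.mono (Finset.union_subset_union_right (toFinset_subset_toFinset h))
  · rw [supported_eq_true hics, List.toFinset_append]
    rfl

theorem satisfies_largestPart (hics : ∀ d, d ∈ ics ↔ d ∈ ic) {M : List (Fact S)}
    (hM : Satisfies M.toFinset ic) (X : List (Fact S)) :
    Satisfies (M.toFinset ∪ (largestPart ics M X).toFinset) ic := by
  refine satisfies_iff_supported.2 fun t ht => ?_
  rcases Finset.mem_union.1 ht with h | h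
  · exact (satisfies_iff_supported.1 hM t h).mono Finset.subset_union_left
  · exact ((mem_largestPart hics M X t).1 (List.mem_toFinset.1 h)).2

/-- A subset of `X` that is consistent with `M` provides its own witnesses and thus survives every
round of filtering. -/
theorem subset_largestPart (hics : ∀ d, d ∈ ics ↔ d ∈ ic) {M X : List (Fact S)} {Y : Instance S}
    (hY : Y ⊆ X.toFinset) (hs : Satisfies (M.toFinset ∪ Y) ic) :
    Y ⊆ (largestPart ics M X).toFinset := by
  refine filterIter_induction (Q := fun Z => Y ⊆ Z.toFinset) hY fun Z hZ t ht => ?_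
  rw [List.mem_toFinset, List.mem_filter, supported_eq_true hics, List.toFinset_append]
  exact ⟨List.mem_toFinset.1 (hY ht),
    (satisfies_iff_supported.1 hs t (Finset.mem_union_right _ ht)).mono
      (Finset.union_subset_union_right hZ)⟩

/-- `X` can be appended to `M`, and `G` can be appended afterwards. -/
def Enables (ic : Set (InclusionDependency S)) (P : Finset (Instance S)) (M G X : Instance S) :
    Prop :=
  Satisfies (M ∪ X) ic ∧ ∀ V, IsLargestWorld ic P (M ∪ X) V → G ⊆ V

theorem Enables.mono {P : Finset (Instance S)} {M G X Y V : Instance S} (h : Enables ic P M G X)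
    (hV : IsLargestWorld ic P (M ∪ X) V) (hY : Satisfies (M ∪ Y) ic) (hXY : X ⊆ Y) :
    Enables ic P M G Y :=
  ⟨hY, fun _ hV' => (h.2 V hV).trans (hV.mono hV' (Finset.union_subset_union_right hXY))⟩

variable {Ts : List (List (Fact S))} {M G : List (Fact S)}

theorem isLargestWorld_append (hics : ∀ d, d ∈ ics ↔ d ∈ ic) (X : List (Fact S))
    (h : Satisfies (M.toFinset ∪ X.toFinset) ic) :
    IsLargestWorld ic (toTransactions Ts) (M.toFinset ∪ X.toFinset)
      (largestWorld ics Ts (M ++ X)).toFinset := by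
  have := isLargestWorld_largestWorld hics Ts (B := M ++ X) (by rwa [List.toFinset_append])
  rwa [List.toFinset_append] at this

theorem enables_iff_contains (hics : ∀ d, d ∈ ics ↔ d ∈ ic) (X : List (Fact S))
    (h : Satisfies (M.toFinset ∪ X.toFinset) ic) :
    Enables ic (toTransactions Ts) M.toFinset G.toFinset X.toFinset ↔
      contains (largestWorld ics Ts (M ++ X)) G = true := by
  have hV := isLargestWorld_append (Ts := Ts) hics X h
  rw [contains_eq_true]
  exact ⟨fun h' => h'.2 _ hV, fun h' => ⟨h, fun V' hV' =>
    h'.trans (hV.mono hV' (Finset.Subset.refl _))⟩⟩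

/-- A failed deletion is final. If the largest consistent part without `t` does not enable `G`, no
subset without `t` does, and later sets only shrink. So every tuple kept to the end is
indispensable. -/
theorem foldl_dropIfPossible (hics : ∀ d, d ∈ ics ↔ d ∈ ic) (hM : Satisfies M.toFinset ic)
    (l : List (Fact S)) : ∀ X : List (Fact S),
    Enables ic (toTransactions Ts) M.toFinset G.toFinset X.toFinset →
    Enables ic (toTransactions Ts) M.toFinset G.toFinset
      (l.foldl (dropIfPossible ics Ts M G) X).toFinset ∧
    ∀ t ∈ l, ∀ Y : Instance S, Y ⊂ (l.foldl (dropIfPossible ics Ts M G) X).toFinset →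
      t ∈ l.foldl (dropIfPossible ics Ts M G) X → t ∉ Y →
      ¬ Enables ic (toTransactions Ts) M.toFinset G.toFinset Y := by
  induction l with
  | nil => exact fun X hX => ⟨hX, by simp⟩
  | cons t l ih =>
    intro X hX
    set X' := dropIfPossible ics Ts M G X t with hX'
    set Z := largestPart ics M (X.filter fun s => !decide (s = t)) with hZ
    have hZs : Satisfies (M.toFinset ∪ Z.toFinset) ic := satisfies_largestPart hics hM _
    have hdrop : X' = bif contains (largestWorld ics Ts (M ++ Z)) G then Z else X := rfl
    have h₁ : Enables ic (toTransactions Ts) M.toFinset G.toFinset X'.toFinset := by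
      rw [hdrop]
      cases hc : contains (largestWorld ics Ts (M ++ Z)) G
      · exact hX
      · exact (enables_iff_contains hics Z hZs).2 hc
    have h₂ : t ∈ X' → ∀ Y : Instance S, Y ⊆ X'.toFinset → t ∉ Y →
        ¬ Enables ic (toTransactions Ts) M.toFinset G.toFinset Y := by
      intro ht Y hY htY hen
      cases hc : contains (largestWorld ics Ts (M ++ Z)) G
      · rw [hdrop, hc, cond_false] at hY
        -- An enabling `Y` without `t` would lie in `Z`; by monotonicity `Z` would enable `G` and
        -- the test would have succeeded.
        have hYZ : Y ⊆ Z.toFinset := subset_largestPart hics (fun s hs => by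
          rw [List.mem_toFinset, List.mem_filter]
          refine ⟨List.mem_toFinset.1 (hY hs), ?_⟩
          have : s ≠ t := fun h => htY (h ▸ hs)
          simpa using this) hen.1
        have hYl := isLargestWorld_append (Ts := Ts) (M := M) hics Y.toList
          (by rw [Finset.toList_toFinset]; exact hen.1)
        rw [Finset.toList_toFinset] at hYl
        have := (enables_iff_contains hics Z hZs).1 (hen.mono hYl hZs hYZ)
        rw [hc] at this
        exact Bool.false_ne_true this
      · rw [hdrop, hc, cond_true, hZ, mem_largestPart hics, List.mem_filter] at ht
        simp at ht
    obtain ⟨h₃, h₄⟩ := ih X' h₁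
    refine ⟨h₃, fun s hs Y hY hsX hsY => ?_⟩
    rcases List.mem_cons.1 hs with rfl | hs
    · have hsub := (foldl_dropIfPossible_sublist ics Ts M G l X').subset
      exact h₂ (hsub hsX) Y (hY.subset.trans (toFinset_subset_toFinset hsub)) hsY
    · exact h₄ s hs Y hY hsX hsY

end Minimization

/-- Distinct attributes on the right bound the width by an arity, so any set of dependencies can be
listed and built into the program. -/
instance finite_inclusionDependency : Finite (InclusionDependency S) := by
  let α := Σ (i j : Fin S.numRel) (w : Fin (S.arity j + 1)),
    (Fin w → Fin (S.arity i)) × {f : Fin w → Fin (S.arity j) // Function.Injective f}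
  let F : α → InclusionDependency S := fun x => ⟨x.1, x.2.1, x.2.2.1, x.2.2.2.1, x.2.2.2.2.1,
    x.2.2.2.2.2⟩
  refine Finite.of_surjective F fun d => ?_
  have hw : d.width < S.arity d.dst + 1 := by
    have := Fintype.card_le_of_injective _ d.rhs_injective
    simp at this
    omega
  exact ⟨⟨d.src, d.dst, ⟨d.width, hw⟩, d.lhs, d.rhs, d.rhs_injective⟩, rfl⟩

theorem solve_correct (hics : ∀ d, d ∈ ics ↔ d ∈ ic) {D : Database S} (hD : D.ic = ic)
    {Tin Tout : Finset (Instance S)} (hTout : Tout ⊆ D.pending)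
    {x : Input S} (hx : x.Represents D Tin Tout) :
    (∀ T, solve ics x = some T → D.IsMinimalSeparating Tin Tout T.toFinset) ∧
      (solve ics x = none → ¬ ∃ T, D.IsSeparating Tin Tout T) := by
  subst hD
  obtain ⟨hs, hp, hin, hout⟩ := hx
  set y : RawInput S := (x.state, (x.pending, (x.tin, x.tout))) with hy
  set M := y.world ics with hMdef
  set C := y.candidate ics with hCdef
  set c := freshConst x.pending.flatten with hc
  have hM : IsLargestWorld D.ic D.pending D.state M.toFinset := by
    rw [← hs, ← hp]
    exact isLargestWorld_largestWorld hics _ (by rw [hs]; exact D.consistent)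
  have hV : ∀ X : List (Fact S), Satisfies (M.toFinset ∪ X.toFinset) D.ic →
      IsLargestWorld D.ic D.pending (M.toFinset ∪ X.toFinset)
        (largestWorld ics x.pending (M ++ X)).toFinset := fun X h => by
    rw [← hp]
    exact isLargestWorld_append hics X h
  have hsep : ∀ (X : List (Fact S)), D.IsSeparating Tin Tout X.toFinset ↔ _ := fun X =>
    isSeparating_iff (Tin := Tin) (Tout := Tout) hM (hV X)
  have hfresh : ∀ T ∈ D.pending, ∀ t ∈ T, ∀ i, t.2 i ≠ c := by
    intro T hT t ht i
    rw [← hp] at hT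
    simp only [toTransactions, List.mem_toFinset, List.mem_map] at hT
    obtain ⟨T, hT, rfl⟩ := hT
    exact ne_freshConst (List.mem_flatten_of_mem hT (List.mem_toFinset.1 ht)) i
  have hG : x.tin.flatten.toFinset = Tin.biUnion id := by
    rw [← hin]
    ext t
    simp [toTransactions]
  have hCs : Satisfies (M.toFinset ∪ C.toFinset) D.ic :=
    hM.sat.union (satisfies_chase hics)
  have hCin : Tin.biUnion id ⊆ C.toFinset := by
    rw [← hG]
    intro t ht
    rw [List.mem_toFinset] at *
    exact subset_chase ht
  have hCV := hV C hCs
  have hCin' := (hCin.trans Finset.subset_union_right).trans hCV.base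
  have hinf : y.infeasible ics = true ↔
      ∃ T ∈ Tout, T ⊆ (largestWorld ics x.pending (M ++ C)).toFinset := by
    simp only [RawInput.infeasible, List.any_eq_true, contains_eq_true, ← hout, toTransactions,
      List.mem_toFinset, List.mem_map]
    constructor
    · rintro ⟨T, hT, h⟩
      exact ⟨_, ⟨T, hT, rfl⟩, h⟩
    · rintro ⟨_, ⟨T, hT, rfl⟩, h⟩
      exact ⟨T, hT, h⟩
  have hsolve : solve ics x = bif y.infeasible ics then none else some (y.minimized ics) := rfl
  rw [hsolve]
  cases hb : y.infeasible ics
  · refine ⟨?_, by simp⟩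
    rintro T hT
    obtain rfl : y.minimized ics = T := by simpa using hT
    have hno : ∀ T' ∈ Tout, ¬ T' ⊆ (largestWorld ics x.pending (M ++ C)).toFinset :=
      fun T' hT' h => by
        have := hinf.2 ⟨T', hT', h⟩
        rw [hb] at this
        exact Bool.false_ne_true this
    have hen : Enables D.ic (toTransactions x.pending) M.toFinset x.tin.flatten.toFinset
        C.toFinset := ⟨hCs, fun V' hV' => by
      rw [hp] at hV'
      rw [hG]
      exact hCin'.trans (hCV.mono hV' (Finset.Subset.refl _))⟩
    obtain ⟨h₁, h₂⟩ := foldl_dropIfPossible (Ts := x.pending) (G := x.tin.flatten) hics hM.sat C C hen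
    have hmin : y.minimized ics =
      C.foldl (dropIfPossible ics x.pending M x.tin.flatten) C := rfl
    rw [← hmin] at h₁ h₂
    have hsub : y.minimized ics ⊆ C := (foldl_dropIfPossible_sublist ics _ _ _ _ _).subset
    rw [hp, hG] at h₁ h₂
    constructor
    -- The exclusion of `Tout` is inherited from `C`, whose largest world is at least as big.
    · rw [hsep]
      refine ⟨h₁.1, h₁.2 _ (hV _ h₁.1), fun T' hT' h => hno T' hT' (h.trans ?_)⟩
      exact (hV _ h₁.1).mono hCV
        (Finset.union_subset_union_right (toFinset_subset_toFinset hsub))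
    · intro Y hY hYsep
      -- A strict subset misses some tuple `t` that was kept when its turn came; being separating,
      -- `Y` would in particular enable `Tin`.
      obtain ⟨t, ht, htY⟩ := Finset.exists_of_ssubset hY
      rw [List.mem_toFinset] at ht
      refine h₂ t (hsub ht) Y hY ht htY ?_
      rw [← Finset.toList_toFinset Y, hsep] at hYsep
      obtain ⟨h₃, h₄, -⟩ := hYsep
      have h₅ := hV _ h₃
      rw [Finset.toList_toFinset] at h₃ h₅
      exact ⟨h₃, fun V' hV' => h₄.trans (h₅.mono hV' (Finset.Subset.refl _))⟩
  · refine ⟨by simp, fun _ => ?_⟩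
    rintro ⟨T, hT⟩
    rw [← Finset.toList_toFinset T, hsep] at hT
    obtain ⟨h₁, h₂, h₃⟩ := hT
    have h₄ := hV _ h₁
    obtain ⟨T', hT', hsub⟩ := hinf.1 hb
    refine h₃ T' hT' fun t ht => ?_
    -- A member of `Tout` is pending, hence free of `c`, and for such tuples domination is
    -- membership. So it would lie in the largest world of the supposed separating `T`.
    refine Dominated.mem (c := c) ?_ (hfresh T' (hTout hT') t ht)
    refine dominated_largestWorld hCV (Finset.subset_union_left.trans h₄.base) ?_ h₄.sat h₄.closed
      hfresh t (hsub ht)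
    intro s hs'
    exact dominated_chase hics h₄.sat (by rw [hG]; exact h₂) s (List.mem_toFinset.1 hs')

end BlockchainDB

theorem mainTheorem5 (S : Schema) (ic : Set (InclusionDependency S)) :
    ∃ f : Input S → Option (List (Fact S)),
      Nonempty (Turing.TM2ComputableInPolyTime encodeInput encodeOutput f) ∧
      ∀ (D : Database S), D.ic = ic →
        ∀ Tin Tout : Finset (Instance S), Tin ⊆ D.pending → Tout ⊆ D.pending →
          ∀ x : Input S, x.Represents D Tin Tout →
            (∀ T, f x = some T → D.IsMinimalSeparating Tin Tout T.toFinset) ∧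
            (f x = none → ¬ ∃ T, D.IsSeparating Tin Tout T) := by
  have hics : ∀ d, d ∈ (Set.toFinite ic).toFinset.toList ↔ d ∈ ic := fun d => by simp
  exact ⟨solve (Set.toFinite ic).toFinset.toList, solve_computable _,
    fun D hD Tin Tout _ hTout x hx => solve_correct hics hD hTout hx⟩
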